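/- Throughout, $G$ is a finite abelian group with uniform probability measure $\mu$, $\mathbb{E}_{x}$ is the average over $x\in G$, and $\widehat G$ is the group of characters of $G$. Write $\mathcal{L}(t)=\log(2/t)$ for $t\in(0,1]$, $\mu_S=\mu(S)^{-1}1_S$ for a non-empty set $S\subseteq G$, and for $f,g\colon G\to\mathbb{R}$ write $(f*g)(x)=\mathbb{E}_y f(y)g(x-y)$ and $(f\circ g)(x)=\mathbb{E}_y f(y)g(y-x)$; also $\|f\|_{L^p(\nu)}=(\mathbb{E}_x|f(x)|^p\nu(x))^{1/p}$ and $\|f\|_\infty=\max_{x\in G}|f(x)|$. For a non-empty set $\Gamma\subseteq\widehat G$ and $\rho\ge 0$, the Bohr set with frequency set $\Gamma$, rank $|\Gamma|$ and width $\rho$ is $\mathrm{Bohr}(\Gamma;\rho)=\{x\in G: |\gamma(x)-1|\le\rho \text{ for all }\gamma\in\Gamma\}$, and its $\delta$-dilate is $\mathrm{Bohr}(\Gamma;\rho)_\delta=\mathrm{Bohr}(\Gamma;\delta\rho)$ (a Bohr set comes with a fixed choice of $\Gamma$ and $\rho$). A Bohr set $B$ of rank $d$ is regular if $(1-100\delta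 d)|B|\le|B_{1-\delta}|\le|B_{1+\delta}|\le(1+100\delta d)|B|$ for all $\delta\in(0,1/(100d)]$. **Proposition 3.4.** There are absolute constants $c,C>0$ such that the following holds. Let $B^{(1)}$ and $B^{(2)}=\mathrm{Bohr}(\Gamma;\rho)$ be regular Bohr sets of rank $d$ in $G$, with $\rho\le 2$, such that $B^{(2)}\subseteq B^{(1)}_{c/d}$. Let $B\subseteq G$ be a non-empty set, and let $A_1,A_2$ be subsets of translates of $B$ with respective densities $\alpha_1=|A_1|/|B|>0$ and $\alpha_2=|A_2|/|B|>0$. Suppose that $$\|\mu_{A_1}\circ\mu_{A_2}\|_{L^p(\mu_{B^{(1)}}*\mu_{B^{(2)}+x})}\ge(1+\varepsilon)\mu(B)^{-1}$$ for some $x\in G$, $\varepsilon\in(0,1]$ and integer $p\ge C\varepsilon^{-1}\mathcal{L}(\varepsilon)$. Then there exist a non-empty set $\Delta\subseteq\widehat G$, of size $d'$ say, and a real number $\rho'$ such that $$d'\ll\varepsilon^{-2}p^2\,\mathcal{L}\bigl(\varepsilon(\alpha_1\alpha_2)^{1/2}\bigr)^2\mathcal{L}(\alpha_1)\mathcal{L}(\alpha_2),\qquad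 \rho'\gg\frac{\rho\,\varepsilon(\alpha_1\alpha_2)^{1/2}}{d^3d'},$$ with absolute implied constants, and $B'=\mathrm{Bohr}(\Gamma\cup\Delta;\rho')$ is a regular Bohr set with $$\|\mu_{A_1}*\mu_{B'}\|_\infty\ge\Bigl(1+\frac{\varepsilon}{2}\Bigr)\mu(B)^{-1}.$$ -/

import Mathlib

open Finset
open scoped BigOperators

noncomputable section

/-- The logarithmic factor `𝓛(t) = log (2 / t)`, used for `t ∈ (0, 1]`. -/
def logFactor (t : ℝ) : ℝ := Real.log (2 / t)

/-- The normalised indicator function `μ_S = μ(S)⁻¹ 1_S` of a non-empty set `S ⊆ G`, where `μ` is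
the uniform probability measure on the finite group `G`, so `μ(S) = |S| / |G|`. -/
def normInd {G : Type*} [Fintype G] (S : Finset G) : G → ℝ :=
  (S : Set G).indicator (fun _ => (S.dens : ℝ)⁻¹)

/-- Convolution `(f * g)(x) = 𝔼_y f(y) g(x - y)` of real functions on a finite abelian group. -/
def convAvg {G : Type*} [AddCommGroup G] [Fintype G] (f g : G → ℝ) : G → ℝ :=
  fun x => 𝔼 y, f y * g (x - y)

/-- Difference convolution `(f ∘ g)(x) = 𝔼_y f(y) g(y - x)` of real functions on a finite abelian
group (the conjugation on the second factor is trivial for real functions). -/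
def diffConvAvg {G : Type*} [AddCommGroup G] [Fintype G] (f g : G → ℝ) : G → ℝ :=
  fun x => 𝔼 y, f y * g (y - x)

/-- The norm `‖f‖_{L^p(ν)} = (𝔼_x |f(x)|^p ν(x))^{1/p}` for `p ∈ [1, ∞)` and a probability density
`ν` with respect to the uniform measure on `G`. -/
def wLpNorm {G : Type*} [Fintype G] (p : ℝ) (ν f : G → ℝ) : ℝ :=
  (𝔼 x, |f x| ^ p * ν x) ^ (1 / p)

/-- The translate `S + x`. -/
def translateBy {G : Type*} [AddCommGroup G] (S : Finset G) (x : G) : Finset G :=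
  S.map (addRightEmbedding x)

open scoped Classical in
/-- The Bohr set `Bohr(Γ; ρ) = {x ∈ G | |γ(x) - 1| ≤ ρ for all γ ∈ Γ}`, with (non-empty) frequency
set `Γ`, rank `|Γ|` and width `ρ ≥ 0`. Its `δ`-dilate is `Bohr(Γ; δρ)`. -/
def bohr {G : Type*} [AddCommGroup G] [Fintype G] (Γ : Finset (AddChar G ℂ)) (ρ : ℝ) : Finset G :=
  Finset.univ.filter (fun x => ∀ γ ∈ Γ, ‖γ x - 1‖ ≤ ρ)

/-- Regularity of the Bohr set with frequency set `Γ` and width `ρ`: with `d = |Γ|` and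
`B = Bohr(Γ; ρ)`, we have `(1 - 100δd)|B| ≤ |B_{1-δ}| ≤ |B_{1+δ}| ≤ (1 + 100δd)|B|` for all
`δ ∈ (0, 1/(100d)]`. As usual, this is a property of the pair `(Γ, ρ)`. -/
def IsRegularBohr {G : Type*} [AddCommGroup G] [Fintype G]
    (Γ : Finset (AddChar G ℂ)) (ρ : ℝ) : Prop :=
  ∀ δ : ℝ, 0 < δ → δ ≤ 1 / (100 * (Γ.card : ℝ)) →
    (1 - 100 * δ * (Γ.card : ℝ)) * ((bohr Γ ρ).card : ℝ) ≤ ((bohr Γ ((1 - δ) * ρ)).card : ℝ) ∧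
    ((bohr Γ ((1 - δ) * ρ)).card : ℝ) ≤ ((bohr Γ ((1 + δ) * ρ)).card : ℝ) ∧
    ((bohr Γ ((1 + δ) * ρ)).card : ℝ) ≤ (1 + 100 * δ * (Γ.card : ℝ)) * ((bohr Γ ρ).card : ℝ)

end

/-! ### Growth of monotone functions via Vitali covering -/

section MonotoneGrowth

/-! Write R = |A₁||A₂|/|B| and r(z) = `repCount A₁ A₂ z`. The hypothesis says that r has p-th moment
at least ((1 + ε)R)^p over sums from B⁽¹⁾ and B⁽²⁾ + x. It suffices to find a translate of B' on
which r has mean at least (1 + ε/2)R: this mean is a sum over a ∈ A₂ of densities of A₁ on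
translates of B', so one such translate must be rich in A₁.

Sifting (`exists_sift`): intersecting B⁽¹⁾ and B⁽²⁾ + x with p random translates (reflected in the
second case) of A₁ and A₂ yields U ⊆ B⁽¹⁾ and A ⊆ B⁽²⁾ + x of relative densities at least α₁^p/4 and
α₂^p/4. All but a proportion ε/32 of the sums u + a satisfy r ≥ (1 + 3ε/4)R; the largeness of p pays
for this.

Almost periodicity (`exists_almost_periods`): by random sampling there is a dense subset T of a
small dilate of B⁽²⁾ such that k shifts from T - T hardly change the proportion of sums u + a in the
popular set. The mean of r over U + A + k(T - T) is therefore still large.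

Fourier analysis (`abs_smoothedRepCount_sub_le`): as a function of a further shift s, this mean has
Fourier coefficients damped by the 2k-th power of those of T. By Parseval it barely moves if every
character in the large spectrum of T is close to 1 at s.

Such shifts form a Bohr set of small extra rank by a relative Chang lemma
(`IsDissociatedMod.card_le`): modulo the large spectrum of a smaller regular Bohr set, which
regularity makes harmless, few characters generate the large spectrum of T. Averaging over B'
finishes the proof. Regular widths exist because |Bohr(Γ; ρ)| grows polynomially in ρ. -/

/-- The increments of a monotone function over disjoint intervals add up to at most its total
increment. -/
lemma Monotone.sum_sub_le_of_pairwiseDisjoint {ι : Type*} {f : ℝ → ℝ} (hf : Monotone f)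
    (a b : ι → ℝ) (lo : ℝ) (F : Finset ι) (hab : ∀ i ∈ F, a i ≤ b i) (hlo : ∀ i ∈ F, lo ≤ a i)
    (hdis : (F : Set ι).PairwiseDisjoint (fun i => Set.Icc (a i) (b i))) (hi : ℝ)
    (hlohi : lo ≤ hi) (hhi : ∀ i ∈ F, b i ≤ hi) :
    ∑ i ∈ F, (f (b i) - f (a i)) ≤ f hi - f lo := by
  classical
  -- The interval with the largest left endpoint lies to the right of all the others, so after
  -- removing it `hi` may be lowered to `a i`.
  induction F using Finset.induction_on_max_value a generalizing hi with
  | empty => simpa using hf hlohi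
  | insert i s his hmax ih =>
    rw [sum_insert his]
    have h1 : ∀ j ∈ s, b j ≤ a i := by
      intro j hj
      by_contra! hlt
      have hne : j ≠ i := fun h => his (h ▸ hj)
      have hd := hdis (by simp [hj]) (by simp) hne
      exact Set.disjoint_left.1 hd (show a i ∈ Set.Icc (a j) (b j) from ⟨hmax j hj, hlt.le⟩)
        ⟨le_rfl, hab i (mem_insert_self _ _)⟩
    have h2 := ih (fun j hj => hab j (mem_insert_of_mem hj))
      (fun j hj => hlo j (mem_insert_of_mem hj))
      (hdis.subset (by simp)) (a i) (hlo i (mem_insert_self _ _)) h1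
    have h3 := hf (hhi i (mem_insert_self _ _))
    linarith

/-- A monotone function that grows with slope at least `κ` on some short interval around each point
of `[u, v]` grows by at least `κ (v - u) / 5` altogether. -/
lemma Monotone.mul_sub_le_of_local_growth {f : ℝ → ℝ} (hf : Monotone f) {u v κ l : ℝ}
    (huv : u ≤ v) (hκ : 0 < κ) (hl : 0 < l)
    (h : ∀ s ∈ Set.Icc u v, ∃ a b, a ≤ s ∧ s ≤ b ∧ a < b ∧ b - a ≤ l ∧ κ * (b - a) ≤ f b - f a) :
    κ * (v - u) ≤ 5 * (f (v + l) - f (u - l)) := by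
  classical
  choose! a b has hsb hab hbal hinc using h
  -- The intervals in `w` are disjoint and their 5-fold enlargements cover [u, v]. Hence v - u is at
  -- most 5 times their total length, while κ times that length is at most the increment of `f`.
  obtain ⟨w, hwt, hwd, hw⟩ := Vitali.exists_disjoint_subfamily_covering_enlargement_closedBall
    (Set.Icc u v) (fun s => (a s + b s) / 2) (fun s => (b s - a s) / 2) l
    (fun s hs => by have := hbal s hs; have := hab s hs; linarith) 5 (by norm_num)
  have hball : ∀ s, Metric.closedBall ((a s + b s) / 2) ((b s - a s) / 2) = Set.Icc (a s) (b s) := by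
    intro s
    rw [Real.closedBall_eq_Icc]
    congr 1 <;> ring
  simp only [hball] at hwd
  have hfin : ∀ F : Finset w, ∑ s ∈ F, (b s - a s) ≤ (f (v + l) - f (u - l)) / κ := by
    intro F
    rw [le_div_iff₀' hκ, mul_sum]
    refine le_trans (sum_le_sum fun s _ => hinc s (hwt s.2)) ?_
    refine hf.sum_sub_le_of_pairwiseDisjoint (fun s : w => a s) (fun s : w => b s) (u - l) F
      (fun s _ => (hab s (hwt s.2)).le) ?_ ?_ _ (by linarith) ?_
    · intro s _
      have h1 := hwt s.2
      have := hsb s h1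
      have := hbal s h1
      have := h1.1
      linarith
    · intro s _ t _ hst
      exact hwd s.2 t.2 (fun h => hst (Subtype.ext h))
    · intro s _
      have h1 := hwt s.2
      have := has s h1
      have := hbal s h1
      have := h1.2
      linarith
  have hcount : w.Countable := by
    refine hwd.countable_of_nonempty_interior fun s hs => ?_
    rw [interior_Icc]
    exact Set.nonempty_Ioo.2 (hab s (hwt hs))
  have hcover : Set.Icc u v ⊆ ⋃ s ∈ w,
      Metric.closedBall ((a s + b s) / 2) (5 * ((b s - a s) / 2)) := by
    intro s hs
    obtain ⟨s', hs', hsub⟩ := hw s hs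
    rw [hball] at hsub
    exact Set.mem_biUnion hs' (hsub ⟨has s hs, hsb s hs⟩)
  have hvol : ENNReal.ofReal (v - u) ≤ ENNReal.ofReal (5 * ((f (v + l) - f (u - l)) / κ)) := by
    calc ENNReal.ofReal (v - u) = MeasureTheory.volume (Set.Icc u v) := by rw [Real.volume_Icc]
      _ ≤ _ := MeasureTheory.measure_mono hcover
      _ ≤ ∑' s : w, MeasureTheory.volume
            (Metric.closedBall ((a s + b s) / 2) (5 * ((b s - a s) / 2))) :=
          MeasureTheory.measure_biUnion_le _ hcount _
      _ = ∑' s : w, ENNReal.ofReal (5 * (b s - a s)) := by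
          refine tsum_congr fun s => ?_
          rw [Real.volume_closedBall]
          congr 1
          ring
      _ ≤ _ := by
          rw [ENNReal.tsum_eq_iSup_sum]
          refine iSup_le fun F => ?_
          rw [← ENNReal.ofReal_sum_of_nonneg, ← mul_sum]
          · exact ENNReal.ofReal_le_ofReal (mul_le_mul_of_nonneg_left (hfin F) (by norm_num))
          · intro s _
            have := hab s (hwt s.2)
            linarith
  have hnn : 0 ≤ f (v + l) - f (u - l) := sub_nonneg.2 (hf (by linarith))
  rw [ENNReal.ofReal_le_ofReal_iff (by positivity)] at hvol
  calc κ * (v - u) ≤ κ * (5 * ((f (v + l) - f (u - l)) / κ)) := by gcongr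
    _ = _ := by field_simp

end MonotoneGrowth

section Translate

variable {G : Type*} [AddCommGroup G]

lemma mem_translateBy {S : Finset G} {x z : G} : z ∈ translateBy S x ↔ z - x ∈ S := by
  simp only [translateBy, mem_map, addRightEmbedding_apply]
  constructor
  · rintro ⟨a, ha, rfl⟩; simpa using ha
  · intro h; exact ⟨_, h, by simp⟩

lemma card_translateBy (S : Finset G) (x : G) : (translateBy S x).card = S.card := card_map _

end Translate

/-! ### Bohr sets: doubling, regular widths, characters of large mean -/

section Bohr

variable {G : Type*} [AddCommGroup G] [Fintype G]

lemma mem_bohr {Γ : Finset (AddChar G ℂ)} {r : ℝ} {x : G} :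
    x ∈ bohr Γ r ↔ ∀ γ ∈ Γ, ‖γ x - 1‖ ≤ r := by
  classical
  simp [bohr]

lemma bohr_mono (Γ : Finset (AddChar G ℂ)) {r s : ℝ} (h : r ≤ s) : bohr Γ r ⊆ bohr Γ s :=
  fun _ hx => mem_bohr.2 fun γ hγ => (mem_bohr.1 hx γ hγ).trans h

lemma bohr_anti {Γ Γ' : Finset (AddChar G ℂ)} (h : Γ ⊆ Γ') (r : ℝ) : bohr Γ' r ⊆ bohr Γ r :=
  fun _ hx => mem_bohr.2 fun γ hγ => mem_bohr.1 hx γ (h hγ)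

lemma zero_mem_bohr (Γ : Finset (AddChar G ℂ)) {r : ℝ} (h : 0 ≤ r) : (0 : G) ∈ bohr Γ r :=
  mem_bohr.2 fun γ _ => by simpa using h

lemma AddChar.norm_add_sub_one_le (γ : AddChar G ℂ) (x y : G) :
    ‖γ (x + y) - 1‖ ≤ ‖γ x - 1‖ + ‖γ y - 1‖ := by
  have h : γ (x + y) - 1 = (γ x - 1) * γ y + (γ y - 1) := by
    rw [AddChar.map_add_eq_mul]; ring
  rw [h]
  refine (norm_add_le _ _).trans ?_
  rw [norm_mul, AddChar.norm_apply, mul_one]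

lemma AddChar.norm_sub_apply (γ : AddChar G ℂ) (x y : G) : ‖γ (x - y) - 1‖ = ‖γ x - γ y‖ := by
  have h : γ x - γ y = (γ (x - y) - 1) * γ y := by
    rw [sub_mul, ← AddChar.map_add_eq_mul]; simp
  rw [h, norm_mul, AddChar.norm_apply, mul_one]

lemma AddChar.norm_neg_sub_one (γ : AddChar G ℂ) (x : G) : ‖γ (-x) - 1‖ = ‖γ x - 1‖ := by
  have := AddChar.norm_sub_apply γ 0 x
  rw [zero_sub] at this
  rw [this, AddChar.map_zero_eq_one, norm_sub_rev]

lemma add_mem_bohr {Γ : Finset (AddChar G ℂ)} {r s : ℝ} {x y : G} (hx : x ∈ bohr Γ r)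
    (hy : y ∈ bohr Γ s) : x + y ∈ bohr Γ (r + s) :=
  mem_bohr.2 fun γ hγ => (AddChar.norm_add_sub_one_le γ x y).trans
    (add_le_add (mem_bohr.1 hx γ hγ) (mem_bohr.1 hy γ hγ))

lemma neg_mem_bohr {Γ : Finset (AddChar G ℂ)} {r : ℝ} {x : G} (hx : x ∈ bohr Γ r) :
    -x ∈ bohr Γ r :=
  mem_bohr.2 fun γ hγ => (AddChar.norm_neg_sub_one γ x).le.trans (mem_bohr.1 hx γ hγ)

lemma sub_mem_bohr {Γ : Finset (AddChar G ℂ)} {r s : ℝ} {x y : G} (hx : x ∈ bohr Γ r)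
    (hy : y ∈ bohr Γ s) : x - y ∈ bohr Γ (r + s) :=
  sub_eq_add_neg x y ▸ add_mem_bohr hx (neg_mem_bohr hy)

/-- Pigeonhole: each value γ x - 1 falls into one of 7 × 7 squares of side 2r/3. Two points sharing
a square for every γ differ by an element of `bohr Γ r`, because 2 · (2/3)² ≤ 1. -/
lemma card_bohr_two_mul_le (Γ : Finset (AddChar G ℂ)) {r : ℝ} (hr : 0 < r) :
    (bohr Γ (2 * r)).card ≤ 49 ^ Γ.card * (bohr Γ r).card := by
  classical
  set q : ℝ := 2 * r / 3 with hq
  have hq0 : 0 < q := by positivity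
  let cell : G → (Γ → ℤ × ℤ) := fun x γ =>
    (⌊((γ : AddChar G ℂ) x - 1).re / q⌋, ⌊((γ : AddChar G ℂ) x - 1).im / q⌋)
  let box : Finset (Γ → ℤ × ℤ) := Fintype.piFinset fun _ => Icc (-3 : ℤ) 3 ×ˢ Icc (-3 : ℤ) 3
  have hfloor : ∀ t : ℝ, |t| ≤ 2 * r → ⌊t / q⌋ ∈ Icc (-3 : ℤ) 3 := by
    intro t ht
    rw [abs_le] at ht
    have h1 : -3 ≤ t / q := by rw [le_div_iff₀ hq0, hq]; linarith
    have h2 : t / q ≤ 3 := by rw [div_le_iff₀ hq0, hq]; linarith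
    rw [mem_Icc]
    constructor
    · exact Int.le_floor.2 (by exact_mod_cast h1)
    · exact_mod_cast (Int.floor_le _).trans h2
  have hmap : ∀ x ∈ bohr Γ (2 * r), cell x ∈ box := by
    intro x hx
    rw [Fintype.mem_piFinset]
    intro γ
    have h := mem_bohr.1 hx γ γ.2
    exact mem_product.2 ⟨hfloor _ ((Complex.abs_re_le_norm _).trans h),
      hfloor _ ((Complex.abs_im_le_norm _).trans h)⟩
  have hclose : ∀ s t : ℝ, ⌊s / q⌋ = ⌊t / q⌋ → (s - t) ^ 2 ≤ q ^ 2 := by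
    intro s t hst
    have := Int.abs_sub_lt_one_of_floor_eq_floor hst
    rw [← sub_div, abs_div, abs_of_pos hq0, div_lt_one hq0] at this
    exact sq_le_sq' (by linarith [neg_abs_le (s - t)]) ((le_abs_self _).trans this.le)
  have hfib : ∀ c ∈ box, ((bohr Γ (2 * r)).filter fun x => cell x = c).card ≤ (bohr Γ r).card := by
    intro c _
    rcases ((bohr Γ (2 * r)).filter fun x => cell x = c).eq_empty_or_nonempty with h | ⟨y, hy⟩
    · simp [h]
    · refine card_le_card_of_injOn (fun x => x - y) ?_ (fun a _ b _ h => by simpa using h)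
      intro x hx
      have hxc := (mem_filter.1 hx).2
      have hyc := (mem_filter.1 hy).2
      refine mem_bohr.2 fun γ hγ => ?_
      rw [AddChar.norm_sub_apply]
      have hcell := congrFun (hxc.trans hyc.symm) ⟨γ, hγ⟩
      have h1 := hclose _ _ (congrArg Prod.fst hcell)
      have h2 := hclose _ _ (congrArg Prod.snd hcell)
      have h3 : ‖γ x - γ y‖ ^ 2 ≤ r ^ 2 := by
        rw [← Complex.normSq_eq_norm_sq, Complex.normSq_apply]
        simp only [Complex.sub_re, Complex.sub_im, Complex.one_re, Complex.one_im] at h1 h2 ⊢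
        have : q ^ 2 = 4 / 9 * r ^ 2 := by rw [hq]; ring
        nlinarith [sq_nonneg r]
      exact le_of_sq_le_sq h3 hr.le
  have := card_le_mul_card_image_of_maps_to hmap _ hfib
  have hbox : box.card = 49 ^ Γ.card := by
    simp [box]
  rw [hbox] at this
  linarith

lemma card_bohr_pos (Γ : Finset (AddChar G ℂ)) {r : ℝ} (hr : 0 ≤ r) : 0 < (bohr Γ r).card :=
  card_pos.2 ⟨0, zero_mem_bohr Γ hr⟩

lemma card_bohr_two_pow_mul_le (Γ : Finset (AddChar G ℂ)) {r : ℝ} (hr : 0 < r) (n : ℕ) :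
    (bohr Γ (2 ^ n * r)).card ≤ (49 ^ Γ.card) ^ n * (bohr Γ r).card := by
  induction n with
  | zero => simp
  | succ n ih =>
    have h := card_bohr_two_mul_le Γ (r := 2 ^ n * r) (by positivity)
    rw [pow_succ', mul_assoc]
    refine h.trans ?_
    rw [pow_succ', mul_assoc]
    exact Nat.mul_le_mul_left _ ih

/-- All dilates of a Bohr set of width 0 coincide. This covers the degenerate case of
`exists_isRegularBohr`. -/
lemma isRegularBohr_zero (Γ : Finset (AddChar G ℂ)) : IsRegularBohr Γ 0 := by
  intro δ hδ _
  simp only [mul_zero, le_refl, true_and]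
  have h1 : (0 : ℝ) ≤ 100 * δ * Γ.card := by positivity
  have h2 : (0 : ℝ) ≤ (bohr Γ 0).card := by positivity
  constructor <;> nlinarith

/-- Around the width of an irregular Bohr set, the logarithm of the size of the Bohr set grows
quickly as a function of the logarithm of the width. -/
lemma exists_growth_of_not_isRegularBohr {Γ : Finset (AddChar G ℂ)} (hΓ : Γ.Nonempty) {s : ℝ}
    (h : ¬ IsRegularBohr Γ (Real.exp s)) :
    ∃ a b, a ≤ s ∧ s ≤ b ∧ a < b ∧ b - a ≤ Real.log 2 ∧
      50 * Γ.card * (b - a) ≤ Real.log (bohr Γ (Real.exp b)).card -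
        Real.log (bohr Γ (Real.exp a)).card := by
  have hd : (1 : ℝ) ≤ Γ.card := by exact_mod_cast hΓ.card_pos
  have hlog2 : (1 / 2 : ℝ) ≤ Real.log 2 := by linarith [Real.log_two_gt_d9]
  simp only [IsRegularBohr, not_forall] at h
  obtain ⟨δ, hδ, hδd, hn⟩ := h
  set d : ℝ := (Γ.card : ℝ)
  have hy1 : 100 * δ * d ≤ 1 := by
    rw [le_div_iff₀ (by positivity)] at hδd
    linarith
  have hδ1 : δ ≤ 1 / 100 := by nlinarith
  have hr := Real.exp_pos s
  have hN : ∀ t, (0 : ℝ) < (bohr Γ (Real.exp t)).card := fun t => by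
    exact_mod_cast card_bohr_pos Γ (Real.exp_pos t).le
  have hy0 : 0 < 100 * δ * d := by positivity
  -- The middle inequality is monotonicity, so an outer one fails: the upper one gives growth to the
  -- right of s, the lower one to the left. With y = 100δd ≤ 1, the slope 50d comes from log(1 + y)
  -- ≥ y/2 and log(1 + δ) ≤ δ, respectively from -log(1 - y) ≥ y and -log(1 - δ) ≤ 2δ.
  by_cases hA : (1 - 100 * δ * d) * (bohr Γ (Real.exp s)).card ≤
      (bohr Γ ((1 - δ) * Real.exp s)).card
  · have hC : ¬ ((bohr Γ ((1 + δ) * Real.exp s)).card : ℝ) ≤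
        (1 + 100 * δ * d) * (bohr Γ (Real.exp s)).card := by
      intro hC
      refine hn ⟨hA, ?_, hC⟩
      exact_mod_cast card_le_card (bohr_mono Γ (by nlinarith))
    push Not at hC
    have hexp : Real.exp (s + Real.log (1 + δ)) = (1 + δ) * Real.exp s := by
      rw [Real.exp_add, Real.exp_log (by linarith), mul_comm]
    have hl1 : Real.log (1 + δ) ≤ δ := by
      have := Real.log_le_sub_one_of_pos (show 0 < 1 + δ by linarith)
      linarith
    have hl0 : 0 < Real.log (1 + δ) := Real.log_pos (by linarith)
    refine ⟨s, s + Real.log (1 + δ), le_rfl, by linarith, by linarith, by linarith, ?_⟩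
    rw [hexp]
    have h1 := Real.log_le_log (mul_pos (by linarith) (hN s)) hC.le
    rw [Real.log_mul (by linarith) (hN s).ne'] at h1
    have h2 := Real.one_sub_inv_le_log_of_pos (show 0 < 1 + 100 * δ * d by linarith)
    have h3 : 50 * δ * d ≤ 1 - (1 + 100 * δ * d)⁻¹ := by
      rw [le_sub_comm, inv_le_iff_one_le_mul₀ (by linarith)]
      nlinarith
    have h4 : 50 * d * (s + Real.log (1 + δ) - s) ≤ 50 * d * δ := by
      apply mul_le_mul_of_nonneg_left _ (by positivity)
      linarith
    linarith
  · push Not at hA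
    have hexp : Real.exp (s + Real.log (1 - δ)) = (1 - δ) * Real.exp s := by
      rw [Real.exp_add, Real.exp_log (by linarith), mul_comm]
    have hpos : 0 < 1 - 100 * δ * d := by
      have h1 := hN (s + Real.log (1 - δ))
      rw [hexp] at h1
      exact pos_of_mul_pos_left (h1.trans hA) (hN s).le
    have hl1 : - (2 * δ) ≤ Real.log (1 - δ) := by
      have := Real.one_sub_inv_le_log_of_pos (show 0 < 1 - δ by linarith)
      have h3 : (1 - δ)⁻¹ ≤ 1 + 2 * δ := by
        rw [inv_le_iff_one_le_mul₀ (by linarith)]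
        nlinarith
      linarith
    have hl0 : Real.log (1 - δ) < 0 := Real.log_neg (by linarith) (by linarith)
    refine ⟨s + Real.log (1 - δ), s, by linarith, le_rfl, by linarith, by linarith, ?_⟩
    have h1 := Real.log_le_log (hN (s + Real.log (1 - δ))) (hexp ▸ hA.le)
    rw [Real.log_mul hpos.ne' (hN s).ne'] at h1
    have h2 := Real.log_le_sub_one_of_pos hpos
    have h4 : 50 * d * (s - (s + Real.log (1 - δ))) ≤ 50 * d * (2 * δ) := by
      apply mul_le_mul_of_nonneg_left _ (by positivity)
      linarith
    linarith

/-- Every Bohr set has a regular dilate with dilation factor in `[1/16, 1]`. -/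
lemma exists_isRegularBohr {Γ : Finset (AddChar G ℂ)} (hΓ : Γ.Nonempty) {R : ℝ} (hR : 0 ≤ R) :
    ∃ r, R / 16 ≤ r ∧ r ≤ R ∧ IsRegularBohr Γ r := by
  rcases hR.eq_or_lt with rfl | hR
  · exact ⟨0, by simp, le_rfl, isRegularBohr_zero Γ⟩
  by_contra! hcon
  have hd : (1 : ℝ) ≤ Γ.card := by exact_mod_cast hΓ.card_pos
  have hlog2 : (0 : ℝ) < Real.log 2 := Real.log_pos (by norm_num)
  have hN : ∀ t, (0 : ℝ) < (bohr Γ (Real.exp t)).card := fun t => by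
    exact_mod_cast card_bohr_pos Γ (Real.exp_pos t).le
  have hmono : Monotone fun s => Real.log (bohr Γ (Real.exp s)).card := by
    intro s t hst
    refine Real.log_le_log (hN s) ?_
    exact_mod_cast card_le_card (bohr_mono Γ (Real.exp_le_exp.2 hst))
  have h16 : Real.log 16 = 4 * Real.log 2 := by
    rw [show (16 : ℝ) = 2 ^ 4 by norm_num, Real.log_pow]; norm_num
  -- If no width in [R/16, R] is regular, the logarithm of the size grows by at least 50d · 4 log 2
  -- / 5 = 40d log 2 from width R/32 to 2R. Six doublings allow at most 6d log 49 ≤ 36d log 2.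
  have key := hmono.mul_sub_le_of_local_growth (u := Real.log (R / 16)) (v := Real.log R)
    (κ := 50 * Γ.card) (l := Real.log 2) (Real.log_le_log (by positivity) (by linarith))
    (by positivity) hlog2 (fun s hs => exists_growth_of_not_isRegularBohr hΓ
      (hcon _ ((Real.log_le_iff_le_exp (by positivity)).1 hs.1)
        ((Real.le_log_iff_exp_le hR).1 hs.2)))
  have hu : Real.exp (Real.log (R / 16) - Real.log 2) = R / 32 := by
    rw [Real.exp_sub, Real.exp_log (by positivity), Real.exp_log (by norm_num)]; ring
  have hv : Real.exp (Real.log R + Real.log 2) = 2 ^ 6 * (R / 32) := by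
    rw [Real.exp_add, Real.exp_log hR, Real.exp_log (by norm_num)]; ring
  have hgrow : Real.log (bohr Γ (2 ^ 6 * (R / 32))).card ≤
      6 * (Γ.card * Real.log 49) + Real.log (bohr Γ (R / 32)).card := by
    have h1 : ((bohr Γ (2 ^ 6 * (R / 32))).card : ℝ) ≤
        (49 ^ Γ.card) ^ 6 * (bohr Γ (R / 32)).card := by
      exact_mod_cast card_bohr_two_pow_mul_le Γ (r := R / 32) (by positivity) 6
    have h2 := hN (Real.log (R / 16) - Real.log 2)
    have h3 := hN (Real.log R + Real.log 2)
    rw [hu] at h2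
    rw [hv] at h3
    have h4 := Real.log_le_log h3 h1
    rw [Real.log_mul (by positivity) h2.ne', Real.log_pow, Real.log_pow] at h4
    exact_mod_cast h4
  have h49 : Real.log 49 ≤ 6 * Real.log 2 := by
    have : Real.log 49 ≤ Real.log (2 ^ 6) := Real.log_le_log (by norm_num) (by norm_num)
    rwa [Real.log_pow] at this
  simp only [hu, hv] at key
  rw [Real.log_div hR.ne' (by norm_num), h16] at key
  have h5 : (Γ.card : ℝ) * Real.log 49 ≤ Γ.card * (6 * Real.log 2) := by gcongr
  have h6 : 0 < (Γ.card : ℝ) * Real.log 2 := by positivity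
  nlinarith

/-- A character with a large mean over a regular Bohr set is almost constant on small dilates. -/
lemma IsRegularBohr.norm_sub_one_mul_norm_sum_le {Γ : Finset (AddChar G ℂ)} {r κ : ℝ}
    (h : IsRegularBohr Γ r) (hκ : 0 < κ) (hκd : κ ≤ 1 / (100 * (Γ.card : ℝ))) (ψ : AddChar G ℂ)
    {t : G} (ht : t ∈ bohr Γ (κ * r)) :
    ‖ψ t - 1‖ * ‖∑ x ∈ bohr Γ r, ψ x‖ ≤ 200 * κ * Γ.card * (bohr Γ r).card := by
  classical
  -- The Bohr set and its translate by t both contain the (1 - κ)-dilate and exceed it by at most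
  -- 100κd|B| points. Their character sums, which differ by the factor ψ t, are thus within 200κd|B|
  -- of each other.
  have hreg := (h κ hκ hκd).1
  have hsub : ∀ y, bohr Γ ((1 - κ) * r) ⊆ bohr Γ r → y ∈ bohr Γ (κ * r) →
      bohr Γ ((1 - κ) * r) ⊆ (bohr Γ r).map (addRightEmbedding y) := by
    intro y _ hy x hx
    refine mem_map.2 ⟨x - y, ?_, by simp⟩
    have := sub_mem_bohr hx hy
    rwa [← add_mul, sub_add_cancel, one_mul] at this
  have hsub0 : bohr Γ ((1 - κ) * r) ⊆ bohr Γ r := by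
    by_cases hr : 0 ≤ r
    · exact bohr_mono Γ (by nlinarith)
    · intro x hx
      refine mem_bohr.2 fun γ hγ => ?_
      have h1 := mem_bohr.1 ht γ hγ
      have h2 := norm_nonneg (γ t - 1)
      nlinarith
  have hdiff : ∀ S : Finset G, bohr Γ ((1 - κ) * r) ⊆ S → S.card = (bohr Γ r).card →
      ‖∑ x ∈ S, ψ x - ∑ x ∈ bohr Γ ((1 - κ) * r), ψ x‖ ≤ 100 * κ * Γ.card * (bohr Γ r).card := by
    intro S hS hc
    rw [← sum_sdiff hS, add_sub_cancel_right]
    refine (norm_sum_le _ _).trans ?_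
    simp only [AddChar.norm_apply, sum_const, nsmul_eq_mul, mul_one]
    rw [cast_card_sdiff hS, hc]
    linarith
  have h1 := hdiff _ hsub0 rfl
  have h2 := hdiff _ (hsub t hsub0 ht) (card_map _)
  have h3 : ∑ x ∈ (bohr Γ r).map (addRightEmbedding t), ψ x = ψ t * ∑ x ∈ bohr Γ r, ψ x := by
    rw [sum_map, mul_sum]
    refine sum_congr rfl fun x _ => ?_
    rw [addRightEmbedding_apply, AddChar.map_add_eq_mul, mul_comm]
  rw [h3] at h2
  rw [← norm_mul, sub_mul, one_mul]
  have h4 := norm_sub_le (ψ t * ∑ x ∈ bohr Γ r, ψ x - ∑ x ∈ bohr Γ ((1 - κ) * r), ψ x)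
    (∑ x ∈ bohr Γ r, ψ x - ∑ x ∈ bohr Γ ((1 - κ) * r), ψ x)
  rw [sub_sub_sub_cancel_right] at h4
  linarith

end Bohr

lemma AddChar.apply_sum_eq_prod {G M ι : Type*} [AddCommMonoid G] [CommMonoid M] (ψ : AddChar G M)
    (s : Finset ι) (v : ι → G) : ψ (∑ i ∈ s, v i) = ∏ i ∈ s, ψ (v i) := by
  classical
  induction s using Finset.induction_on with
  | empty => simp
  | insert i s hi ih => rw [sum_insert hi, prod_insert hi, AddChar.map_add_eq_mul, ih]

/-! ### Dissociation and a relative Chang lemma -/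

section Dissociation

variable {G : Type*} [AddCommGroup G]

/-- A set of characters is dissociated modulo a set `E` of characters if no non-trivial product of
its elements with exponents in `{-1, 0, 1}` lies in `E`. -/
def IsDissociatedMod (E : Set (AddChar G ℂ)) (Λ : Finset (AddChar G ℂ)) : Prop :=
  ∀ e : AddChar G ℂ → ℤ, (∀ ψ, e ψ ∈ ({-1, 0, 1} : Finset ℤ)) → (∃ ψ ∈ Λ, e ψ ≠ 0) →
    ∏ ψ ∈ Λ, ψ ^ e ψ ∉ E

lemma IsDissociatedMod.subset {E : Set (AddChar G ℂ)} {Λ Λ' : Finset (AddChar G ℂ)}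
    (h : IsDissociatedMod E Λ) (hsub : Λ' ⊆ Λ) : IsDissociatedMod E Λ' := by
  classical
  rintro e he ⟨ψ, hψ, hne⟩
  have := h (fun ψ => if ψ ∈ Λ' then e ψ else 0)
    (fun ψ => by
      by_cases hψ : ψ ∈ Λ'
      · simpa [hψ] using he ψ
      · simp [hψ])
    ⟨ψ, hsub hψ, by simpa [hψ] using hne⟩
  rw [← prod_subset hsub (fun ψ _ hψ => by simp [hψ])] at this
  rwa [prod_congr rfl fun ψ hψ => by rw [if_pos hψ]] at this

/-- The sum of a character over an `N`-fold sumset with multiplicities factorises. -/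
lemma AddChar.sum_sum_piFinset_apply (χ : AddChar G ℂ) (W S : Finset G) (N : ℕ) :
    ∑ v ∈ Fintype.piFinset (fun _ : Fin N => S), ∑ w ∈ W, χ (w + ∑ i, v i) =
      (∑ w ∈ W, χ w) * (∑ x ∈ S, χ x) ^ N := by
  have h : ∀ v : Fin N → G, ∑ w ∈ W, χ (w + ∑ i, v i) = (∑ w ∈ W, χ w) * ∏ i, χ (v i) := by
    intro v
    rw [sum_mul]
    refine sum_congr rfl fun w _ => ?_
    rw [AddChar.map_add_eq_mul, AddChar.apply_sum_eq_prod]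
  simp_rw [h]
  rw [← mul_sum, Finset.sum_prod_piFinset S (fun (_ : Fin N) x => χ x)]
  simp

variable [Fintype G]

lemma AddChar.norm_mul_sub_one_le (γ ψ : AddChar G ℂ) (t : G) :
    ‖(γ * ψ) t - 1‖ ≤ ‖γ t - 1‖ + ‖ψ t - 1‖ := by
  have h : (γ * ψ) t - 1 = (γ t - 1) * ψ t + (ψ t - 1) := by
    rw [AddChar.mul_apply]; ring
  rw [h]
  refine (norm_add_le _ _).trans ?_
  rw [norm_mul, AddChar.norm_apply, mul_one]

lemma AddChar.norm_prod_sub_one_le (Λ : Finset (AddChar G ℂ)) (g : AddChar G ℂ → AddChar G ℂ)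
    (t : G) : ‖(∏ ψ ∈ Λ, g ψ) t - 1‖ ≤ ∑ ψ ∈ Λ, ‖g ψ t - 1‖ := by
  classical
  induction Λ using Finset.induction_on with
  | empty => simp
  | insert ψ Λ hψ ih =>
    rw [prod_insert hψ, sum_insert hψ]
    exact (AddChar.norm_mul_sub_one_le _ _ t).trans (by linarith)

lemma AddChar.norm_zpow_sub_one_le (ψ : AddChar G ℂ) {e : ℤ} (he : e ∈ ({-1, 0, 1} : Finset ℤ))
    (t : G) : ‖(ψ ^ e) t - 1‖ ≤ ‖ψ t - 1‖ := by
  simp only [mem_insert, mem_singleton] at he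
  rcases he with rfl | rfl | rfl
  · rw [zpow_neg_one, AddChar.inv_apply, AddChar.norm_neg_sub_one]
  · simp
  · simp

/-- If `Λ` is dissociated modulo `E` but `Λ ∪ {γ}` is not, then `γ` is the product of an element of
`E` and elements of `Λ`, up to inversion. -/
lemma IsDissociatedMod.exists_norm_sub_one_le {E : Set (AddChar G ℂ)} {Λ : Finset (AddChar G ℂ)}
    (h : IsDissociatedMod E Λ) [DecidableEq (AddChar G ℂ)] {γ : AddChar G ℂ} (hγ : γ ∉ Λ)
    (hins : ¬ IsDissociatedMod E (insert γ Λ)) :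
    ∃ ψ ∈ E, ∀ t, ‖γ t - 1‖ ≤ ‖ψ t - 1‖ + ∑ χ ∈ Λ, ‖χ t - 1‖ := by
  simp only [IsDissociatedMod, not_forall, not_not] at hins
  obtain ⟨e, he, hex, hE⟩ := hins
  rw [prod_insert hγ] at hE
  refine ⟨_, hE, fun t => ?_⟩
  have hneg : ∀ ψ, -e ψ ∈ ({-1, 0, 1} : Finset ℤ) := fun ψ => by
    have := he ψ
    simp only [mem_insert, mem_singleton] at this ⊢
    omega
  -- With exponent 0 at γ the relation would contradict the dissociation of Λ. So the exponent is ±1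
  -- and the relation can be solved for γ.
  have hγ0 : e γ ≠ 0 := by
    intro h0
    obtain ⟨ψ, hψ, hne⟩ := hex
    rw [h0, zpow_zero, one_mul] at hE
    rcases mem_insert.1 hψ with rfl | hψ
    · exact hne h0
    · exact h e he ⟨ψ, hψ, hne⟩ hE
  have hpow : γ ^ e γ = (γ ^ e γ * ∏ ψ ∈ Λ, ψ ^ e ψ) * ∏ ψ ∈ Λ, ψ ^ (-e ψ) := by
    rw [mul_assoc, ← prod_mul_distrib]
    simp
  have hγe : ‖γ t - 1‖ = ‖(γ ^ e γ) t - 1‖ := by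
    have := he γ
    simp only [mem_insert, mem_singleton, hγ0, false_or] at this
    rcases this with h1 | h1 <;> rw [h1]
    · rw [zpow_neg_one, AddChar.inv_apply, AddChar.norm_neg_sub_one]
    · rw [zpow_one]
  rw [hγe]
  conv_lhs => rw [hpow]
  refine (AddChar.norm_mul_sub_one_le _ _ t).trans (add_le_add le_rfl ?_)
  exact (AddChar.norm_prod_sub_one_le Λ _ t).trans
    (sum_le_sum fun ψ _ => AddChar.norm_zpow_sub_one_le ψ (hneg ψ) t)

/-- The Riesz product of a set of characters that is dissociated modulo the characters with a large
mean over `S` has small mean with respect to an `N`-fold sumset of `S`. -/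
lemma IsDissociatedMod.sum_riesz_le {S W : Finset G} {N : ℕ} {Λ : Finset (AddChar G ℂ)}
    (hΛ : IsDissociatedMod {ψ | (S.card : ℝ) / 2 < ‖∑ x ∈ S, ψ x‖} Λ)
    (ω : AddChar G ℂ → ℂ) (hω : ∀ ψ, ‖ω ψ‖ = 1) {a b : ℝ} (ha : 0 ≤ a) (hb : 0 ≤ b) :
    ∑ v ∈ Fintype.piFinset (fun _ : Fin N => S), ∑ w ∈ W,
        ∏ ψ ∈ Λ, (a + b * (ω ψ * ψ (w + ∑ i, v i)).re) ≤
      W.card * (S.card : ℝ) ^ N * (a ^ Λ.card + (a + b) ^ Λ.card / 2 ^ N) := by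
  classical
  let J : Finset ℤ := {-1, 0, 1}
  let c : AddChar G ℂ → ℤ → ℂ := fun ψ j =>
    if j = 0 then (a : ℂ) else if j = 1 then (b / 2 : ℂ) * ω ψ else (b / 2 : ℂ) * (ω ψ)⁻¹
  let X : (Λ → ℤ) → AddChar G ℂ := fun e => ∏ ψ : Λ, (ψ : AddChar G ℂ) ^ e ψ
  have hfac : ∀ (ψ : AddChar G ℂ) (x : G), ((a + b * (ω ψ * ψ x).re : ℝ) : ℂ) =
      ∑ j ∈ J, c ψ j * (ψ x) ^ j := by
    intro ψ x
    have hre : (((ω ψ * ψ x).re : ℝ) : ℂ) = (ω ψ * ψ x + (ω ψ)⁻¹ * (ψ x)⁻¹) / 2 := by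
      have hu : ‖ω ψ * ψ x‖ = 1 := by rw [norm_mul, hω, AddChar.norm_apply, one_mul]
      rw [← mul_inv, Complex.inv_eq_conj hu, Complex.re_eq_add_conj]
    push_cast
    rw [hre]
    simp only [J, c]
    rw [sum_insert (by decide), sum_insert (by decide), sum_singleton]
    simp
    ring
  have hexp : ∀ x : G, ((∏ ψ ∈ Λ, (a + b * (ω ψ * ψ x).re) : ℝ) : ℂ) =
      ∑ e ∈ Fintype.piFinset (fun _ : Λ => J), (∏ ψ : Λ, c ψ (e ψ)) * X e x := by
    intro x
    rw [Complex.ofReal_prod, ← Finset.prod_coe_sort]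
    simp_rw [hfac]
    rw [Finset.prod_univ_sum]
    refine sum_congr rfl fun e _ => ?_
    rw [prod_mul_distrib]
    simp only [X]
    rw [AddChar.prod_apply]
    simp only [AddChar.zpow_apply]
  -- Dissociation enters here: a non-zero exponent vector gives a character outside the large
  -- spectrum of `S`, so each of the N summands from `S` saves a factor 2.
  have hX0 : ∀ e ∈ Fintype.piFinset (fun _ : Λ => J), e ≠ 0 →
      ‖∑ x ∈ S, X e x‖ ≤ (S.card : ℝ) / 2 := by
    intro e he hne
    have hJ := Fintype.mem_piFinset.1 he
    by_contra! hlt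
    obtain ⟨ψ, hψ⟩ := Function.ne_iff.1 hne
    let e' : AddChar G ℂ → ℤ := fun ψ => if h : ψ ∈ Λ then e ⟨ψ, h⟩ else 0
    refine hΛ e' ?_ ⟨ψ, ψ.2, by simpa [e'] using hψ⟩ ?_
    · intro ψ
      by_cases h : ψ ∈ Λ
      · simpa [e', h, J] using hJ ⟨ψ, h⟩
      · simp [e', h]
    · have : ∏ ψ ∈ Λ, ψ ^ e' ψ = X e := by
        rw [← Finset.prod_coe_sort]
        refine Fintype.prod_congr _ _ fun ψ => ?_
        simp [e']
      rw [this]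
      exact hlt
  have htriv : ∀ (χ : AddChar G ℂ) (U : Finset G), ‖∑ x ∈ U, χ x‖ ≤ U.card := by
    intro χ U
    refine (norm_sum_le _ _).trans ?_
    simp [AddChar.norm_apply]
  have hXbound : ∀ e ∈ Fintype.piFinset (fun _ : Λ => J),
      ‖(∑ w ∈ W, X e w) * (∑ x ∈ S, X e x) ^ N‖ ≤
        W.card * (S.card : ℝ) ^ N * ((if e = 0 then 1 else 0) + 1 / 2 ^ N) := by
    intro e he
    rw [norm_mul, norm_pow, mul_assoc]
    refine mul_le_mul (htriv _ _) ?_ (by positivity) (by positivity)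
    by_cases h0 : e = 0
    · rw [if_pos h0]
      have h1 := pow_le_pow_left₀ (norm_nonneg _) (htriv (X e) S) N
      have h2 : (0 : ℝ) ≤ (S.card : ℝ) ^ N * (1 / 2 ^ N) := by positivity
      linarith
    · rw [if_neg h0, zero_add]
      refine (pow_le_pow_left₀ (norm_nonneg _) (hX0 e he h0) N).trans (le_of_eq ?_)
      rw [div_pow]; ring
  have hc0 : ∀ ψ, ‖c ψ 0‖ = a := by
    intro ψ
    simp [c, abs_of_nonneg ha]
  have hcsum : ∀ ψ, ∑ j ∈ J, ‖c ψ j‖ = a + b := by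
    intro ψ
    simp only [J, c]
    rw [sum_insert (by decide), sum_insert (by decide), sum_singleton]
    simp [hω, abs_of_nonneg ha, abs_of_nonneg hb]
    ring
  calc ∑ v ∈ Fintype.piFinset (fun _ : Fin N => S), ∑ w ∈ W,
        ∏ ψ ∈ Λ, (a + b * (ω ψ * ψ (w + ∑ i, v i)).re)
      ≤ ‖((∑ v ∈ Fintype.piFinset (fun _ : Fin N => S), ∑ w ∈ W,
        ∏ ψ ∈ Λ, (a + b * (ω ψ * ψ (w + ∑ i, v i)).re) : ℝ) : ℂ)‖ := by
        rw [Complex.norm_real]; exact le_abs_self _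
    _ = ‖∑ e ∈ Fintype.piFinset (fun _ : Λ => J), (∏ ψ : Λ, c ψ (e ψ)) *
          ((∑ w ∈ W, X e w) * (∑ x ∈ S, X e x) ^ N)‖ := by
        congr 1
        simp only [Complex.ofReal_sum]
        simp_rw [hexp, ← AddChar.sum_sum_piFinset_apply, mul_sum]
        rw [sum_comm]
        conv_rhs => rw [sum_comm]
        rw [sum_comm]
        refine sum_congr rfl fun v _ => ?_
        rw [sum_comm]
    _ ≤ ∑ e ∈ Fintype.piFinset (fun _ : Λ => J), (∏ ψ : Λ, ‖c ψ (e ψ)‖) *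
          (W.card * (S.card : ℝ) ^ N * ((if e = 0 then 1 else 0) + 1 / 2 ^ N)) := by
        refine (norm_sum_le _ _).trans (sum_le_sum fun e he => ?_)
        rw [norm_mul, norm_prod]
        exact mul_le_mul_of_nonneg_left (hXbound e he) (prod_nonneg fun _ _ => norm_nonneg _)
    _ = W.card * (S.card : ℝ) ^ N *
          (∑ e ∈ Fintype.piFinset (fun _ : Λ => J),
            (∏ ψ : Λ, ‖c ψ (e ψ)‖) * (if e = 0 then 1 else 0) +
          (∑ e ∈ Fintype.piFinset (fun _ : Λ => J), ∏ ψ : Λ, ‖c ψ (e ψ)‖) / 2 ^ N) := by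
        rw [sum_div, ← sum_add_distrib, mul_sum]
        refine sum_congr rfl fun e _ => ?_
        ring
    _ = _ := by
        congr 2
        · simp only [mul_ite, mul_one, mul_zero]
          rw [sum_ite_eq', if_pos (Fintype.mem_piFinset.2 fun _ => by simp [J])]
          simp [hc0]
        · rw [← Finset.prod_univ_sum (fun _ : Λ => J) (fun ψ j => ‖c ψ j‖)]
          simp_rw [hcsum]
          simp

/-- Chang's lemma relative to a set `W` containing the `N`-fold sums `T - S - ⋯ - S`: a set of
characters in the large spectrum of `T` which is dissociated modulo the large spectrum of `S` is
small. -/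
lemma IsDissociatedMod.card_le {S W T : Finset G} {N : ℕ} {Λ : Finset (AddChar G ℂ)}
    (hΛ : IsDissociatedMod {ψ | (S.card : ℝ) / 2 < ‖∑ x ∈ S, ψ x‖} Λ) (hS : S.Nonempty)
    (hT : T.Nonempty) (hN : Λ.card ≤ N)
    (hW : ∀ x ∈ T, ∀ v : Fin N → G, (∀ i, v i ∈ S) → x - ∑ i, v i ∈ W)
    (hspec : ∀ ψ ∈ Λ, (T.card : ℝ) / 2 ≤ ‖∑ x ∈ T, ψ x‖) :
    (Λ.card : ℝ) ≤ 8 * Real.log (2 * W.card / T.card) := by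
  classical
  have hT0 : (0 : ℝ) < T.card := by exact_mod_cast hT.card_pos
  have hS0 : (0 : ℝ) < S.card := by exact_mod_cast hS.card_pos
  choose ω hω1 hω2 using fun ψ : AddChar G ℂ => Complex.exists_norm_eq_mul_self (∑ x ∈ T, ψ x)
  set a := Real.cosh (1 / 2) with ha
  set b := Real.sinh (1 / 2) with hb
  have ha0 : 0 < a := Real.cosh_pos _
  have hb0 : 0 < b := Real.sinh_pos_iff.2 (by norm_num)
  set n : ℝ := (Λ.card : ℝ) with hn
  let g : G → ℝ := fun x => ∏ ψ ∈ Λ, (a + b * (ω ψ * ψ x).re)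
  let f : G → ℝ := fun x => ∑ ψ ∈ Λ, (ω ψ * ψ x).re
  have hre : ∀ ψ (x : G), |(ω ψ * ψ x).re| ≤ 1 := fun ψ x => by
    refine (Complex.abs_re_le_norm _).trans ?_
    rw [norm_mul, hω1, AddChar.norm_apply, one_mul]
  -- The chord of z ↦ exp(z/2) over [-1, 1] is a + bz, so the Riesz product `g` dominates exp(f/2).
  have hstep : ∀ ψ (x : G), Real.exp (1 / 2 * (ω ψ * ψ x).re) ≤ a + b * (ω ψ * ψ x).re := by
    intro ψ x
    have := Real.exp_mul_le_cosh_add_mul_sinh (hre ψ x) (1 / 2)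
    rw [mul_comm (1 / 2 : ℝ), mul_comm b]
    exact this
  have hfg : ∀ x, Real.exp (1 / 2 * f x) ≤ g x := by
    intro x
    simp only [f, g]
    rw [mul_sum, Real.exp_sum]
    exact prod_le_prod (fun _ _ => (Real.exp_pos _).le) fun ψ _ => hstep ψ x
  have hg0 : ∀ x, 0 ≤ g x := fun x => (Real.exp_pos _).le.trans (hfg x)
  have hfT : n / 2 * T.card ≤ ∑ x ∈ T, f x := by
    simp only [f]
    rw [sum_comm]
    have : ∀ ψ ∈ Λ, (T.card : ℝ) / 2 ≤ ∑ x ∈ T, (ω ψ * ψ x).re := by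
      intro ψ hψ
      rw [← Complex.re_sum, ← mul_sum, ← hω2, Complex.ofReal_re]
      exact hspec ψ hψ
    have := sum_le_sum this
    rw [sum_const, nsmul_eq_mul] at this
    linarith
  -- Jensen, through the tangent of exp at n/4: the mean of f/2 over `T` is at least n/4.
  have hlow : T.card * Real.exp (n / 4) ≤ ∑ x ∈ T, g x := by
    have h1 : ∀ x ∈ T, Real.exp (n / 4) * (1 + (1 / 2 * f x - n / 4)) ≤ g x := by
      intro x _
      refine le_trans ?_ (hfg x)
      have h2 := Real.add_one_le_exp (1 / 2 * f x - n / 4)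
      calc _ ≤ Real.exp (n / 4) * Real.exp (1 / 2 * f x - n / 4) := by
            apply mul_le_mul_of_nonneg_left _ (Real.exp_pos _).le
            linarith
        _ = _ := by rw [← Real.exp_add]; congr 1; ring
    refine le_trans ?_ (sum_le_sum h1)
    rw [← mul_sum, sum_add_distrib, sum_sub_distrib, ← mul_sum, mul_comm]
    simp only [sum_const, nsmul_eq_mul, mul_one]
    apply mul_le_mul_of_nonneg_left _ (Real.exp_pos _).le
    linarith
  have hup : (S.card : ℝ) ^ N * ∑ x ∈ T, g x ≤
      ∑ v ∈ Fintype.piFinset (fun _ : Fin N => S), ∑ w ∈ W, g (w + ∑ i, v i) := by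
    have : ∀ v ∈ Fintype.piFinset (fun _ : Fin N => S),
        ∑ x ∈ T, g x ≤ ∑ w ∈ W, g (w + ∑ i, v i) := by
      intro v hv
      have hv' := Fintype.mem_piFinset.1 hv
      have h1 : ∑ x ∈ T, g x = ∑ w ∈ T.image (fun x => x - ∑ i, v i), g (w + ∑ i, v i) := by
        rw [sum_image (fun x _ y _ h => by simpa using h)]
        simp
      rw [h1]
      refine sum_le_sum_of_subset_of_nonneg ?_ fun _ _ _ => hg0 _
      intro w hw
      obtain ⟨x, hx, rfl⟩ := mem_image.1 hw
      exact hW x hx v hv'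
    have := sum_le_sum this
    rwa [sum_const, Fintype.card_piFinset_const, nsmul_eq_mul, Nat.cast_pow] at this
  have hriesz := hΛ.sum_riesz_le (W := W) (N := N) ω hω1 ha0.le hb0.le
  have hab : a + b = Real.exp (1 / 2) := Real.cosh_add_sinh _
  -- The error term of the Riesz product is harmless since e^{1/2} ≤ 2 and |Λ| ≤ N. The main term
  -- satisfies cosh(1/2)^n ≤ e^{n/8}, which loses to e^{n/4}.
  have hab2 : (a + b) ^ Λ.card / 2 ^ N ≤ 1 := by
    rw [div_le_one (by positivity), hab]
    have he2 : Real.exp (1 / 2) ≤ 2 := by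
      rw [← Real.le_log_iff_exp_le (by norm_num)]
      linarith [Real.log_two_gt_d9]
    exact (pow_le_pow_left₀ (Real.exp_pos _).le he2 _).trans
      (pow_le_pow_right₀ (by norm_num) hN)
  have ha1 : 1 ≤ a ^ Λ.card := one_le_pow₀ (Real.one_le_cosh _)
  have ha2 : a ^ Λ.card ≤ Real.exp (n / 8) := by
    refine (pow_le_pow_left₀ ha0.le (Real.cosh_le_exp_half_sq _) _).trans (le_of_eq ?_)
    rw [← Real.exp_nat_mul]
    congr 1
    rw [hn]; ring
  have hmain : T.card * Real.exp (n / 4) ≤ W.card * (2 * Real.exp (n / 8)) := by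
    have h1 : (S.card : ℝ) ^ N * (T.card * Real.exp (n / 4)) ≤
        (S.card : ℝ) ^ N * (W.card * (2 * Real.exp (n / 8))) := by
      calc _ ≤ (S.card : ℝ) ^ N * ∑ x ∈ T, g x := by gcongr
        _ ≤ _ := hup
        _ ≤ _ := hriesz
        _ ≤ W.card * (S.card : ℝ) ^ N * (2 * Real.exp (n / 8)) := by
            gcongr
            linarith
        _ = _ := by ring
    exact le_of_mul_le_mul_left h1 (by positivity)
  have hexp : Real.exp (n / 4) = Real.exp (n / 8) * Real.exp (n / 8) := by
    rw [← Real.exp_add]; congr 1; ring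
  rw [hexp] at hmain
  have h8 : Real.exp (n / 8) ≤ 2 * W.card / T.card := by
    rw [le_div_iff₀ hT0]
    refine le_of_mul_le_mul_right ?_ (Real.exp_pos (n / 8))
    linarith
  have := (Real.le_log_iff_exp_le ((Real.exp_pos _).trans_le h8)).2 h8
  linarith

/-- The large spectrum of `T` is controlled by few characters together with the large spectrum of
`S`. -/
lemma exists_card_le_forall_spectrum {S W T : Finset G} {N : ℕ} (hS : S.Nonempty)
    (hT : T.Nonempty) (hW : ∀ x ∈ T, ∀ v : Fin N → G, (∀ i, v i ∈ S) → x - ∑ i, v i ∈ W)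
    (hN : 8 * Real.log (2 * W.card / T.card) < N) :
    ∃ Λ : Finset (AddChar G ℂ), Λ.card ≤ N ∧
      ∀ γ : AddChar G ℂ, (T.card : ℝ) / 2 ≤ ‖∑ x ∈ T, γ x‖ →
        ∃ ψ : AddChar G ℂ, (S.card : ℝ) / 2 < ‖∑ x ∈ S, ψ x‖ ∧
          ∀ t, ‖γ t - 1‖ ≤ ‖ψ t - 1‖ + ∑ χ ∈ Λ, ‖χ t - 1‖ := by
  classical
  set E : Set (AddChar G ℂ) := {ψ | (S.card : ℝ) / 2 < ‖∑ x ∈ S, ψ x‖} with hE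
  have hS0 : (0 : ℝ) < S.card := by exact_mod_cast hS.card_pos
  let P : Finset (Finset (AddChar G ℂ)) := univ.filter fun Λ =>
    IsDissociatedMod E Λ ∧ ∀ ψ ∈ Λ, (T.card : ℝ) / 2 ≤ ‖∑ x ∈ T, ψ x‖
  have hP : P.Nonempty := ⟨∅, by simp [P, IsDissociatedMod]⟩
  obtain ⟨Λ, hΛP, hmax⟩ := exists_max_image P card hP
  obtain ⟨hΛ, hspec⟩ := (mem_filter.1 hΛP).2
  refine ⟨Λ, ?_, fun γ hγ => ?_⟩
  -- `IsDissociatedMod.card_le` requires at most N characters, so it is applied to a subset of Λ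
  -- with exactly N elements.
  · by_contra! hlt
    obtain ⟨Λ', hsub, hcard⟩ := exists_subset_card_eq hlt.le
    have := (hΛ.subset hsub).card_le hS hT hcard.le hW fun ψ hψ => hspec ψ (hsub hψ)
    rw [hcard] at this
    linarith
  · by_cases hγΛ : γ ∈ Λ
    · refine ⟨1, by simpa using hS.card_pos, fun t => ?_⟩
      simp only [AddChar.one_apply, sub_self, norm_zero, zero_add]
      exact single_le_sum (f := fun χ : AddChar G ℂ => ‖χ t - 1‖) (fun _ _ => norm_nonneg _) hγΛ
    · refine hΛ.exists_norm_sub_one_le hγΛ fun hins => ?_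
      have hmem : insert γ Λ ∈ P := by
        refine mem_filter.2 ⟨mem_univ _, hins, fun ψ hψ => ?_⟩
        rcases mem_insert.1 hψ with rfl | hψ
        · exact hγ
        · exact hspec ψ hψ
      have := hmax _ hmem
      rw [card_insert_of_notMem hγΛ] at this
      omega

end Dissociation

/-! ### Croot–Sisask almost periodicity -/

section AlmostPeriodicity

/-- Khintchine-type moment bound for sums of independent samples of a bounded function with mean
zero. -/
lemma sum_piFinset_sum_pow_le {α : Type*} (A : Finset α) (φ : α → ℝ) (hφ : ∀ a ∈ A, |φ a| ≤ 1)
    (hmean : ∑ a ∈ A, φ a = 0) {l m : ℕ} (hl : 0 < l) (hm : 0 < m) :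
    ∑ b ∈ Fintype.piFinset (fun _ : Fin l => A), (∑ i, φ (b i)) ^ (2 * m) ≤
      2 * (A.card : ℝ) ^ l * (6 * m * l) ^ m := by
  classical
  have hl0 : (0 : ℝ) < l := by exact_mod_cast hl
  have hm0 : (0 : ℝ) < m := by exact_mod_cast hm
  -- This s makes the exponential moment e^{ls²/2} equal to e^m. The bound (2m)!/s^{2m} ≤ (2ml)^m
  -- then yields (2e·ml)^m, and 2e ≤ 6.
  set s : ℝ := √(2 * m / l) with hs
  have hs2 : s ^ 2 = 2 * m / l := Real.sq_sqrt (by positivity)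
  have hs0 : 0 < s := Real.sqrt_pos.2 (by positivity)
  have hmgf : ∀ c : ℝ, c ^ 2 = s ^ 2 →
      ∑ b ∈ Fintype.piFinset (fun _ : Fin l => A), Real.exp (c * ∑ i, φ (b i)) ≤
        (A.card : ℝ) ^ l * Real.exp 1 ^ m := by
    intro c hc
    have h1 : ∑ a ∈ A, Real.exp (c * φ a) ≤ A.card * Real.exp (s ^ 2 / 2) := by
      calc ∑ a ∈ A, Real.exp (c * φ a)
          ≤ ∑ a ∈ A, (Real.cosh c + φ a * Real.sinh c) := by
            refine sum_le_sum fun a ha => ?_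
            have := Real.exp_mul_le_cosh_add_mul_sinh (hφ a ha) c
            rwa [mul_comm c]
        _ = A.card * Real.cosh c := by
            rw [sum_add_distrib, ← sum_mul, hmean]; simp
        _ ≤ A.card * Real.exp (s ^ 2 / 2) := by
            rw [← hc]
            gcongr
            exact Real.cosh_le_exp_half_sq c
    simp_rw [mul_sum, Real.exp_sum]
    rw [Finset.sum_prod_piFinset A (fun (_ : Fin l) a => Real.exp (c * φ a))]
    rw [prod_const, card_univ, Fintype.card_fin]
    refine (pow_le_pow_left₀ (sum_nonneg fun _ _ => (Real.exp_pos _).le) h1 l).trans (le_of_eq ?_)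
    rw [mul_pow, ← Real.exp_nat_mul, ← Real.exp_nat_mul, hs2]
    congr 2
    field_simp
  have hpt : ∀ z : ℝ, z ^ (2 * m) ≤
      (2 * m : ℕ).factorial / s ^ (2 * m) * (Real.exp (s * z) + Real.exp (-s * z)) := by
    intro z
    have h1 := Real.pow_div_factorial_le_exp (s * |z|) (by positivity) (2 * m)
    have h2 : Real.exp (s * |z|) ≤ Real.exp (s * z) + Real.exp (-s * z) := by
      rcases abs_cases z with ⟨h, _⟩ | ⟨h, _⟩ <;> rw [h]
      · linarith [Real.exp_pos (-s * z)]
      · rw [mul_neg, ← neg_mul]; linarith [Real.exp_pos (s * z)]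
    have h3 : (s * |z|) ^ (2 * m) = s ^ (2 * m) * z ^ (2 * m) := by
      rw [mul_pow, (even_two_mul m).pow_abs]
    rw [h3] at h1
    have h4 := h1.trans h2
    rw [div_le_iff₀ (by positivity)] at h4
    rw [div_mul_eq_mul_div, le_div_iff₀ (by positivity)]
    linarith
  have hfact : ((2 * m : ℕ).factorial : ℝ) ≤ (2 * m) ^ (2 * m) := by
    have := Nat.factorial_le_pow (2 * m)
    exact_mod_cast this
  calc ∑ b ∈ Fintype.piFinset (fun _ : Fin l => A), (∑ i, φ (b i)) ^ (2 * m)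
      ≤ ∑ b ∈ Fintype.piFinset (fun _ : Fin l => A), (2 * m : ℕ).factorial / s ^ (2 * m) *
          (Real.exp (s * ∑ i, φ (b i)) + Real.exp (-s * ∑ i, φ (b i))) :=
        sum_le_sum fun b _ => hpt _
    _ ≤ (2 * m : ℕ).factorial / s ^ (2 * m) *
          ((A.card : ℝ) ^ l * Real.exp 1 ^ m + (A.card : ℝ) ^ l * Real.exp 1 ^ m) := by
        rw [← mul_sum, sum_add_distrib]
        exact mul_le_mul_of_nonneg_left (add_le_add (hmgf s rfl) (hmgf (-s) (neg_sq s)))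
          (by positivity)
    _ ≤ (2 * m) ^ (2 * m) / s ^ (2 * m) *
          ((A.card : ℝ) ^ l * Real.exp 1 ^ m + (A.card : ℝ) ^ l * Real.exp 1 ^ m) := by
        gcongr
    _ = 2 * (A.card : ℝ) ^ l * (2 * Real.exp 1 * m * l) ^ m := by
        rw [pow_mul s, hs2, pow_mul, ← div_pow]
        have : ((2 * m : ℝ) ^ 2 / (2 * m / l)) = 2 * m * l := by field_simp
        rw [this, show (2 * Real.exp 1 * m * l : ℝ) = (2 * m * l) * Real.exp 1 by ring,
          mul_pow _ (Real.exp 1)]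
        ring
    _ ≤ _ := by
        gcongr
        linarith [Real.exp_one_lt_d9]

variable {G : Type*} [AddCommGroup G] [Fintype G]

/-- Croot–Sisask sampling: most `l`-tuples of elements of `A` approximate the mean over `A` of the
translates of `f` well in `L^{2m}`. -/
lemma card_le_two_mul_card_filter_sample (A Y : Finset G) (f : G → ℝ) (hA : A.Nonempty)
    (hf0 : ∀ z, 0 ≤ f z) (hf1 : ∀ z, f z ≤ 1) (hY : ∀ y, ∀ a ∈ A, f (y + a) ≠ 0 → y ∈ Y)
    {l m : ℕ} (hl : 0 < l) (hm : 0 < m) :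
    (A.card : ℝ) ^ l ≤ 2 * ((Fintype.piFinset (fun _ : Fin l => A)).filter fun b =>
      ∑ y, ((∑ i, f (y + b i)) / l - (∑ a ∈ A, f (y + a)) / A.card) ^ (2 * m) ≤
        4 * Y.card * (6 * m / l : ℝ) ^ m).card := by
  classical
  have hl0 : (0 : ℝ) < l := by exact_mod_cast hl
  have hA0 : (0 : ℝ) < A.card := by exact_mod_cast hA.card_pos
  set P := Fintype.piFinset (fun _ : Fin l => A) with hP
  set h : G → ℝ := fun y => (∑ a ∈ A, f (y + a)) / A.card with hh
  set X : (Fin l → G) → ℝ := fun b => ∑ y, ((∑ i, f (y + b i)) / l - h y) ^ (2 * m) with hX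
  set E : ℝ := 4 * Y.card * (6 * m / l : ℝ) ^ m with hE
  have hh0 : ∀ y, 0 ≤ h y := fun y => div_nonneg (sum_nonneg fun _ _ => hf0 _) hA0.le
  have hh1 : ∀ y, h y ≤ 1 := fun y => by
    rw [hh, div_le_one hA0]
    refine (sum_le_sum fun a _ => hf1 (y + a)).trans ?_
    simp
  have hzero : ∀ b ∈ P, ∀ y, y ∉ Y → ((∑ i, f (y + b i)) / l - h y) ^ (2 * m) = 0 := by
    intro b hb y hy
    have hz : ∀ a ∈ A, f (y + a) = 0 := fun a ha => by
      by_contra hne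
      exact hy (hY y a ha hne)
    have h1 : ∑ i, f (y + b i) = 0 :=
      sum_eq_zero fun i _ => hz _ (Fintype.mem_piFinset.1 hb i)
    have h2 : h y = 0 := by rw [hh]; simp only; rw [sum_eq_zero hz, zero_div]
    rw [h1, h2]
    simp [hm.ne']
  have hmom : ∀ y, ∑ b ∈ P, ((∑ i, f (y + b i)) / l - h y) ^ (2 * m) ≤
      2 * (A.card : ℝ) ^ l * (6 * m / l : ℝ) ^ m := by
    intro y
    have h1 := sum_piFinset_sum_pow_le A (fun a => f (y + a) - h y)
      (fun a _ => abs_le.2 ⟨by linarith [hf0 (y + a), hh1 y], by linarith [hf1 (y + a), hh0 y]⟩)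
      (by
        rw [sum_sub_distrib, sum_const, nsmul_eq_mul, hh]
        simp only
        rw [mul_div_cancel₀ _ hA0.ne', sub_self]) hl hm
    have h2 : ∀ b : Fin l → G, ((∑ i, f (y + b i)) / l - h y) ^ (2 * m) =
        (∑ i, (f (y + b i) - h y)) ^ (2 * m) / (l : ℝ) ^ (2 * m) := by
      intro b
      rw [← div_pow]
      congr 1
      rw [sum_sub_distrib, sum_const, card_univ, Fintype.card_fin, nsmul_eq_mul]
      field_simp
    simp_rw [h2]
    rw [← sum_div, div_le_iff₀ (by positivity)]
    refine h1.trans (le_of_eq ?_)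
    rw [pow_mul, mul_assoc _ _ (((l : ℝ) ^ 2) ^ m), ← mul_pow]
    congr 2
    field_simp
  -- The average of `X` over all tuples is at most E/2, so by Markov at least half of them satisfy X
  -- ≤ E.
  have htot : ∑ b ∈ P, X b ≤ (A.card : ℝ) ^ l / 2 * E := by
    calc ∑ b ∈ P, X b = ∑ b ∈ P, ∑ y ∈ Y, ((∑ i, f (y + b i)) / l - h y) ^ (2 * m) := by
          refine sum_congr rfl fun b hb => ?_
          exact (sum_subset (subset_univ Y) fun y _ hy => hzero b hb y hy).symm
      _ = ∑ y ∈ Y, ∑ b ∈ P, ((∑ i, f (y + b i)) / l - h y) ^ (2 * m) := sum_comm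
      _ ≤ ∑ y ∈ Y, 2 * (A.card : ℝ) ^ l * (6 * m / l : ℝ) ^ m := sum_le_sum fun y _ => hmom y
      _ = _ := by rw [sum_const, nsmul_eq_mul, hE]; ring
  have hX0 : ∀ b, 0 ≤ X b := fun b => sum_nonneg fun y _ => (even_two_mul m).pow_nonneg _
  by_contra! hlt
  have hcard := card_filter_add_card_filter_not (s := P) (fun b => X b ≤ E)
  have hPcard : (P.card : ℝ) = (A.card : ℝ) ^ l := by
    rw [hP, Fintype.card_piFinset_const, Nat.cast_pow]
  have hbad : (A.card : ℝ) ^ l / 2 < (P.filter fun b => ¬ X b ≤ E).card := by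
    have h1 : ((P.filter fun b => X b ≤ E).card : ℝ) + (P.filter fun b => ¬ X b ≤ E).card =
        (A.card : ℝ) ^ l := by rw [← hPcard, ← hcard]; push_cast; rfl
    linarith
  have hne : (P.filter fun b => ¬ X b ≤ E).Nonempty := by
    rw [← card_pos]
    have : (0 : ℝ) < (P.filter fun b => ¬ X b ≤ E).card := lt_trans (by positivity) hbad
    exact_mod_cast this
  have h1 : ((P.filter fun b => ¬ X b ≤ E).card : ℝ) * E <
      ∑ b ∈ P.filter fun b => ¬ X b ≤ E, X b := by
    rw [← nsmul_eq_mul, ← sum_const]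
    exact sum_lt_sum_of_nonempty hne fun b hb => not_le.1 (mem_filter.1 hb).2
  have h2 : ∑ b ∈ P.filter fun b => ¬ X b ≤ E, X b ≤ ∑ b ∈ P, X b :=
    sum_le_sum_of_subset_of_nonneg (filter_subset _ _) fun b _ _ => hX0 b
  have hE0 : 0 ≤ E := by positivity
  nlinarith

/-- Croot–Sisask almost periodicity: the function `u ↦ 𝔼_{y ∈ U, a ∈ A} f (y + a + u)` is almost
invariant under a large set of shifts. -/
lemma exists_almost_periods (A S W Y U : Finset G) (f : G → ℝ) (hA : A.Nonempty)
    (hU : U.Nonempty) (hf0 : ∀ z, 0 ≤ f z) (hf1 : ∀ z, f z ≤ 1)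
    (hY : ∀ y, ∀ a ∈ A, f (y + a) ≠ 0 → y ∈ Y) (hW : ∀ a ∈ A, ∀ t ∈ S, a + t ∈ W)
    {l m : ℕ} (hl : 0 < l) (hm : 0 < m) {η : ℝ} (hη : 0 ≤ η)
    (hηl : 4 * Y.card * (24 * m / l : ℝ) ^ m ≤ U.card * η ^ (2 * m)) :
    ∃ T ⊆ S, (S.card : ℝ) * (A.card : ℝ) ^ l ≤ 2 * T.card * (W.card : ℝ) ^ l ∧
      ∀ u, ∀ t ∈ T, ∀ t' ∈ T,
        |(∑ y ∈ U, ∑ a ∈ A, f (y + a + (u + (t - t')))) / (U.card * A.card) -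
          (∑ y ∈ U, ∑ a ∈ A, f (y + a + u)) / (U.card * A.card)| ≤ η := by
  classical
  have hl0 : (0 : ℝ) < l := by exact_mod_cast hl
  have hA0 : (0 : ℝ) < A.card := by exact_mod_cast hA.card_pos
  have hU0 : (0 : ℝ) < U.card := by exact_mod_cast hU.card_pos
  set h : G → ℝ := fun y => (∑ a ∈ A, f (y + a)) / A.card with hh
  set E : ℝ := 4 * Y.card * (6 * m / l : ℝ) ^ m with hE
  set good := (Fintype.piFinset (fun _ : Fin l => A)).filter fun b =>
      ∑ y, ((∑ i, f (y + b i)) / l - h y) ^ (2 * m) ≤ E with hgood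
  have hgcard : (A.card : ℝ) ^ l ≤ 2 * good.card :=
    card_le_two_mul_card_filter_sample A Y f hA hf0 hf1 hY hl hm
  -- Pigeonhole over pairs of t ∈ S and a good tuple g: all tuples g + t lie in W^l, so one tuple b
  -- arises from many t. For these t the translates of `h` by t are all close to the same function,
  -- the sample mean of b, hence to each other.
  let T : (Fin l → G) → Finset G := fun b => S.filter fun t => (fun i => b i - t) ∈ good
  have hdouble : S.card * good.card ≤ ∑ b ∈ Fintype.piFinset (fun _ : Fin l => W), (T b).card := by
    have hconst : S.card * good.card = ∑ _t ∈ S, good.card := by rw [sum_const, smul_eq_mul]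
    simp only [T, card_filter]
    rw [sum_comm, hconst]
    refine sum_le_sum fun t ht => ?_
    rw [← card_filter]
    refine card_le_card_of_injOn (fun g i => g i + t) ?_ ?_
    · intro g hg
      have hgA := Fintype.mem_piFinset.1 (mem_filter.1 hg).1
      refine mem_coe.2 (mem_filter.2 ⟨Fintype.mem_piFinset.2 fun i => hW _ (hgA i) t ht, ?_⟩)
      simpa using hg
    · intro g _ g' _ hgg
      funext i
      simpa using congrFun hgg i
  have hex : ∃ b, S.card * good.card ≤ W.card ^ l * (T b).card := by
    by_contra! hcon
    have hWpos : (Fintype.piFinset (fun _ : Fin l => W)).Nonempty := by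
      by_contra hemp
      rw [not_nonempty_iff_eq_empty] at hemp
      have := hcon 0
      rw [hemp, sum_empty] at hdouble
      omega
    have h1 := sum_lt_sum_of_nonempty hWpos fun b _ => hcon b
    rw [← mul_sum, sum_const, Fintype.card_piFinset_const, smul_eq_mul] at h1
    exact absurd (lt_of_mul_lt_mul_left' h1) (not_lt.2 hdouble)
  obtain ⟨b, hb⟩ := hex
  have hshift : ∀ t ∈ T b, ∑ y, (h (y + t) - (∑ i, f (y + b i)) / l) ^ (2 * m) ≤ E := by
    intro t ht
    have h1 := (mem_filter.1 (mem_filter.1 ht).2).2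
    rw [← Equiv.sum_comp (Equiv.addRight t)] at h1
    refine le_trans (le_of_eq (sum_congr rfl fun y _ => ?_)) h1
    rw [← (even_two_mul m).neg_pow, neg_sub]
    simp only [Equiv.coe_addRight]
    congr 4
    funext i
    congr 1
    abel
  refine ⟨T b, filter_subset _ _, ?_, ?_⟩
  · have h1 : (S.card : ℝ) * good.card ≤ (W.card : ℝ) ^ l * (T b).card := by exact_mod_cast hb
    have h2 : (S.card : ℝ) * (A.card : ℝ) ^ l ≤ S.card * (2 * good.card) := by gcongr
    linarith
  · intro u t ht t' ht'
    have hD : ∀ w, (∑ y ∈ U, ∑ a ∈ A, f (y + a + w)) / (U.card * A.card) =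
        ∑ y ∈ U, (1 / (U.card : ℝ)) * h (y + w) := by
      intro w
      rw [← mul_sum, hh]
      simp only
      rw [← sum_div, div_mul_div_comm, one_mul]
      congr 1
      refine sum_congr rfl fun y _ => sum_congr rfl fun a _ => ?_
      rw [add_right_comm]
    rw [hD, hD, ← sum_sub_distrib]
    simp_rw [← mul_sub]
    have hjen := Real.pow_arith_mean_le_arith_mean_pow_of_even U (fun _ => 1 / (U.card : ℝ))
      (fun y => h (y + (u + (t - t'))) - h (y + u)) (fun _ _ => by positivity)
      (by rw [sum_const, nsmul_eq_mul]; field_simp) (even_two_mul m)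
    have htri : ∀ y, (h (y + t) - h (y + t')) ^ (2 * m) ≤ 2 ^ (2 * m - 1) *
        ((h (y + t) - (∑ i, f (y + b i)) / l) ^ (2 * m) +
          (h (y + t') - (∑ i, f (y + b i)) / l) ^ (2 * m)) := by
      intro y
      have := (even_two_mul m).add_pow_le (a := h (y + t) - (∑ i, f (y + b i)) / l)
        (b := -(h (y + t') - (∑ i, f (y + b i)) / l))
      rw [(even_two_mul m).neg_pow] at this
      refine le_trans (le_of_eq ?_) this
      congr 1
      ring
    have hsum : ∑ y, (h (y + t) - h (y + t')) ^ (2 * m) ≤ 2 ^ (2 * m) * E := by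
      refine (sum_le_sum fun y _ => htri y).trans ?_
      rw [← mul_sum, sum_add_distrib]
      have h1 := hshift t ht
      have h2 := hshift t' ht'
      have h3 : (2 : ℝ) ^ (2 * m) = 2 ^ (2 * m - 1) * 2 := by
        rw [← pow_succ]; congr 1; omega
      rw [h3, mul_assoc]
      gcongr
      linarith
    have hsumU : ∑ y ∈ U, (h (y + (u + (t - t'))) - h (y + u)) ^ (2 * m) ≤ 2 ^ (2 * m) * E := by
      refine le_trans ?_ hsum
      rw [← Equiv.sum_comp (Equiv.addRight (u - t'))]
      refine le_trans (sum_le_sum_of_subset_of_nonneg (subset_univ U)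
        fun _ _ _ => (even_two_mul m).pow_nonneg _) (le_of_eq (sum_congr rfl fun y _ => ?_))
      simp only [Equiv.coe_addRight]
      rw [show y + (u - t') + t = y + (u + (t - t')) by abel, show y + (u - t') + t' = y + u by abel]
    have h2E : (2 : ℝ) ^ (2 * m) * E ≤ U.card * η ^ (2 * m) := by
      refine le_trans (le_of_eq ?_) hηl
      rw [hE, pow_mul]
      have : (24 * m / l : ℝ) = 2 ^ 2 * (6 * m / l) := by ring
      rw [this, mul_pow]
      ring
    have hfin : |∑ y ∈ U, 1 / (U.card : ℝ) * (h (y + (u + (t - t'))) - h (y + u))| ^ (2 * m) ≤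
        η ^ (2 * m) := by
      rw [(even_two_mul m).pow_abs]
      refine hjen.trans ?_
      rw [← mul_sum, one_div, inv_mul_le_iff₀ hU0]
      exact hsumU.trans h2E
    exact (pow_le_pow_iff_left₀ (abs_nonneg _) hη (by omega)).1 hfin

end AlmostPeriodicity

/-! ### Sifting, or dependent random choice -/

section Sifting

lemma card_filter_forall_fin {α : Type*} [Fintype α] (Q : α → Prop) [DecidablePred Q] (p : ℕ)
    [DecidablePred fun s : Fin p → α => ∀ i, Q (s i)] :
    ((univ : Finset (Fin p → α)).filter fun s => ∀ i, Q (s i)).card =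
      ((univ : Finset α).filter Q).card ^ p := by
  rw [← Fintype.card_piFinset_const]
  congr 1
  ext s
  simp

/-- The first moment of either random set in `exists_sift`; the permutations used there are x ↦ u +
x and x ↦ x - b. -/
lemma sum_card_filter_forall_fin {G : Type*} [Fintype G] [DecidableEq G] (A B : Finset G) (p : ℕ)
    (e : G → Equiv.Perm G) :
    ∑ s : Fin p → G, ((B.filter fun u => ∀ i, e u (s i) ∈ A).card : ℝ) =
      B.card * (A.card : ℝ) ^ p := by
  simp_rw [card_filter, Nat.cast_sum]
  rw [sum_comm]
  have : ∀ u, ∑ s : Fin p → G, ((if ∀ i, e u (s i) ∈ A then 1 else 0 : ℕ) : ℝ) =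
      (A.card : ℝ) ^ p := by
    intro u
    rw [← Nat.cast_sum, ← card_filter, card_filter_forall_fin (fun x => e u x ∈ A), Nat.cast_pow]
    congr 2
    refine card_bij (fun x _ => e u x) (fun x hx => (mem_filter.1 hx).2)
      (fun x _ y _ h => (e u).injective h) fun a ha => ⟨(e u).symm a, by simpa using ha, by simp⟩
  simp_rw [this]
  rw [sum_const, nsmul_eq_mul]

variable {G : Type*} [AddCommGroup G] [DecidableEq G]

/-- The number of representations of `z` as a difference `a₁ - a₂` with `a₁ ∈ A₁` and
`a₂ ∈ A₂`. -/
def repCount (A₁ A₂ : Finset G) (z : G) : ℕ := (A₂.filter fun a => z + a ∈ A₁).card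

variable [Fintype G]

lemma card_filter_add_mem_sub_mem (A₁ A₂ : Finset G) (u b : G) :
    ((univ : Finset G).filter fun x => u + x ∈ A₁ ∧ x - b ∈ A₂).card =
      repCount A₁ A₂ (u + b) := by
  refine card_nbij' (fun x => x - b) (fun a => a + b) ?_ ?_ ?_ ?_
  · intro x hx
    obtain ⟨h1, h2⟩ := (mem_filter.1 hx).2
    exact mem_coe.2 (mem_filter.2 ⟨h2, by rwa [add_assoc, add_sub_cancel]⟩)
  · intro a ha
    obtain ⟨h1, h2⟩ := mem_filter.1 ha
    refine mem_coe.2 (mem_filter.2 ⟨mem_univ _, ?_, by simpa using h1⟩)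
    rwa [show u + (a + b) = u + b + a by abel]
  · intro x _; simp
  · intro a _; simp

/-- For fixed (u, b) the p coordinates of s are constrained independently, each having `repCount A₁
A₂ (u + b)` admissible values. A random s therefore favours pairs with many representations. -/
lemma sum_sum_sum_sift (A₁ A₂ B₁ B₂ : Finset G) (p : ℕ) (w : G → G → ℝ) :
    ∑ s : Fin p → G, ∑ u ∈ B₁.filter (fun u => ∀ i, u + s i ∈ A₁),
        ∑ b ∈ B₂.filter (fun b => ∀ i, s i - b ∈ A₂), w u b =
      ∑ u ∈ B₁, ∑ b ∈ B₂, w u b * (repCount A₁ A₂ (u + b) : ℝ) ^ p := by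
  simp_rw [sum_filter]
  rw [sum_comm]
  refine sum_congr rfl fun u _ => ?_
  have h1 : ∀ s : Fin p → G, (if ∀ i, u + s i ∈ A₁ then
      ∑ b ∈ B₂, (if ∀ i, s i - b ∈ A₂ then w u b else 0) else 0) =
      ∑ b ∈ B₂, (if ∀ i, u + s i ∈ A₁ ∧ s i - b ∈ A₂ then w u b else 0) := by
    intro s
    simp only [forall_and, ite_and]
    split_ifs <;> simp
  simp_rw [h1]
  rw [sum_comm]
  refine sum_congr rfl fun b _ => ?_
  rw [← sum_filter, sum_const, nsmul_eq_mul, mul_comm,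
    card_filter_forall_fin (fun x => u + x ∈ A₁ ∧ x - b ∈ A₂), card_filter_add_mem_sub_mem,
    Nat.cast_pow]

/-- Sifting (dependent random choice): if the `p`-th moment of the representation function is
large, then there are reasonably dense `A₁' ⊆ B₁` and `A₂' ⊆ B₂` such that almost all sums lie where
the representation function is large. -/
lemma exists_sift (A₁ A₂ B₁ B₂ : Finset G) (p : ℕ) {N M τ δ : ℝ} (hN : 0 < N) (hδ : 0 < δ)
    (hA₁ : A₁.Nonempty) (hA₂ : A₂.Nonempty) (hB₁ : B₁.Nonempty) (hB₂ : B₂.Nonempty)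
    (hM : A₁.card * A₂.card / N ≤ M) (hτ : 0 ≤ τ) (hτM : τ ^ p ≤ δ / 4 * M ^ p)
    (hmom : B₁.card * B₂.card * M ^ p ≤
      ∑ u ∈ B₁, ∑ b ∈ B₂, (repCount A₁ A₂ (u + b) : ℝ) ^ p) :
    ∃ A₁' ⊆ B₁, ∃ A₂' ⊆ B₂, (A₁.card / N) ^ p * B₁.card / 4 ≤ A₁'.card ∧
      (A₂.card / N) ^ p * B₂.card / 4 ≤ A₂'.card ∧
      ∑ u ∈ A₁', ∑ b ∈ A₂', (if (repCount A₁ A₂ (u + b) : ℝ) < τ then (1 : ℝ) else 0) ≤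
        δ * (A₁'.card * A₂'.card) := by
  by_contra! hcon
  have h1 : (0 : ℝ) < A₁.card := by exact_mod_cast hA₁.card_pos
  have h2 : (0 : ℝ) < A₂.card := by exact_mod_cast hA₂.card_pos
  have h3 : (0 : ℝ) < B₁.card := by exact_mod_cast hB₁.card_pos
  have h4 : (0 : ℝ) < B₂.card := by exact_mod_cast hB₂.card_pos
  set x₁ : ℝ := (A₁.card / N) ^ p * B₁.card / 4 with hx₁
  set x₂ : ℝ := (A₂.card / N) ^ p * B₂.card / 4 with hx₂
  have hx₁0 : 0 ≤ x₁ := by positivity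
  have hx₂0 : 0 ≤ x₂ := by positivity
  have hM0 : 0 < M := lt_of_lt_of_le (by positivity) hM
  let S₁ : (Fin p → G) → Finset G := fun s => B₁.filter fun u => ∀ i, u + s i ∈ A₁
  let S₂ : (Fin p → G) → Finset G := fun s => B₂.filter fun b => ∀ i, s i - b ∈ A₂
  let bad : G → G → ℝ := fun u b => if (repCount A₁ A₂ (u + b) : ℝ) < τ then (1 : ℝ) else 0
  set Tot : ℝ := ∑ u ∈ B₁, ∑ b ∈ B₂, (repCount A₁ A₂ (u + b) : ℝ) ^ p with hTot
  have hTotpos : 0 < Tot := lt_of_lt_of_le (by positivity) hmom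
  have hsumTot : ∑ s, ((S₁ s).card * (S₂ s).card : ℝ) = Tot := by
    have := sum_sum_sum_sift A₁ A₂ B₁ B₂ p fun _ _ => 1
    simp only [sum_const, nsmul_eq_mul, mul_one, one_mul] at this
    rw [hTot, ← this]
  have hsumBad : ∑ s, ∑ u ∈ S₁ s, ∑ b ∈ S₂ s, bad u b ≤ δ / 4 * Tot := by
    rw [sum_sum_sum_sift]
    calc ∑ u ∈ B₁, ∑ b ∈ B₂, bad u b * (repCount A₁ A₂ (u + b) : ℝ) ^ p
        ≤ ∑ u ∈ B₁, ∑ b ∈ B₂, τ ^ p := by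
          refine sum_le_sum fun u _ => sum_le_sum fun b _ => ?_
          simp only [bad]
          split_ifs with hlt
          · rw [one_mul]
            exact pow_le_pow_left₀ (Nat.cast_nonneg _) hlt.le p
          · rw [zero_mul]; positivity
      _ = B₁.card * B₂.card * τ ^ p := by
          simp only [sum_const, nsmul_eq_mul]; ring
      _ ≤ B₁.card * B₂.card * (δ / 4 * M ^ p) := by gcongr
      _ = δ / 4 * (B₁.card * B₂.card * M ^ p) := by ring
      _ ≤ _ := by gcongr
  have hsum₁ : ∑ s, ((S₁ s).card : ℝ) = B₁.card * (A₁.card : ℝ) ^ p :=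
    sum_card_filter_forall_fin A₁ B₁ p fun u => Equiv.addLeft u
  have hsum₂ : ∑ s, ((S₂ s).card : ℝ) = B₂.card * (A₂.card : ℝ) ^ p :=
    sum_card_filter_forall_fin A₂ B₂ p fun b => Equiv.subRight b
  -- For each s either the bad pairs exceed the proportion δ or one of the two sets is below its
  -- threshold. Summed over s, each of the three terms on the right is at most δ·Tot/4, against
  -- δ·Tot on the left.
  have hpt : ∀ s, δ * ((S₁ s).card * (S₂ s).card) ≤ ∑ u ∈ S₁ s, ∑ b ∈ S₂ s, bad u b +
      δ * (x₁ * (S₂ s).card + x₂ * (S₁ s).card) := by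
    intro s
    have hbad0 : 0 ≤ ∑ u ∈ S₁ s, ∑ b ∈ S₂ s, bad u b :=
      sum_nonneg fun u _ => sum_nonneg fun b _ => by simp only [bad]; split_ifs <;> norm_num
    have hc₁ : (0 : ℝ) ≤ (S₁ s).card := Nat.cast_nonneg _
    have hc₂ : (0 : ℝ) ≤ (S₂ s).card := Nat.cast_nonneg _
    have hp₁ : 0 ≤ x₁ * (S₂ s).card := by positivity
    have hp₂ : 0 ≤ x₂ * (S₁ s).card := by positivity
    by_cases ha : x₁ ≤ (S₁ s).card
    · by_cases hb : x₂ ≤ (S₂ s).card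
      · have := hcon (S₁ s) (filter_subset _ _) (S₂ s) (filter_subset _ _) ha hb
        have hnn : 0 ≤ δ * (x₁ * (S₂ s).card + x₂ * (S₁ s).card) := by positivity
        linarith
      · have : ((S₁ s).card : ℝ) * (S₂ s).card ≤ x₂ * (S₁ s).card := by
          rw [mul_comm]; gcongr; exact (not_le.1 hb).le
        have := mul_le_mul_of_nonneg_left (this.trans (le_add_of_nonneg_left hp₁)) hδ.le
        linarith
    · have : ((S₁ s).card : ℝ) * (S₂ s).card ≤ x₁ * (S₂ s).card := by
        gcongr; exact (not_le.1 ha).le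
      have := mul_le_mul_of_nonneg_left (this.trans (le_add_of_nonneg_right hp₂)) hδ.le
      linarith
  have hall := sum_le_sum fun s (_ : s ∈ (univ : Finset (Fin p → G))) => hpt s
  rw [sum_add_distrib, ← mul_sum, ← mul_sum, sum_add_distrib, ← mul_sum, ← mul_sum, hsumTot,
    hsum₁, hsum₂] at hall
  have hR : B₁.card * B₂.card * (A₁.card * A₂.card / N) ^ p ≤ Tot :=
    le_trans (by gcongr) hmom
  have hx₁' : x₁ * (B₂.card * (A₂.card : ℝ) ^ p) =
      B₁.card * B₂.card * (A₁.card * A₂.card / N) ^ p / 4 := by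
    rw [hx₁]; simp only [div_pow, mul_pow]; ring
  have hx₂' : x₂ * (B₁.card * (A₁.card : ℝ) ^ p) =
      B₁.card * B₂.card * (A₁.card * A₂.card / N) ^ p / 4 := by
    rw [hx₂]; simp only [div_pow, mul_pow]; ring
  rw [hx₁', hx₂'] at hall
  have := mul_pos hδ hTotpos
  nlinarith

end Sifting

/-! ### Fourier analysis of the smoothed representation function -/

section Fourier

/-- The k differences are added one at a time, each at cost η. -/
lemma abs_sub_le_of_forall_shift {G : Type*} [AddCommGroup G] {D : G → ℝ} {T : Finset G} {η : ℝ}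
    (hD : ∀ u, ∀ t ∈ T, ∀ t' ∈ T, |D (u + (t - t')) - D u| ≤ η) {k : ℕ} (v : Fin k → G × G)
    (hv : ∀ i, v i ∈ T ×ˢ T) : |D (∑ i, ((v i).1 - (v i).2)) - D 0| ≤ k * η := by
  have h : ∀ F : Finset (Fin k), |D (∑ i ∈ F, ((v i).1 - (v i).2)) - D 0| ≤ F.card * η := by
    intro F
    induction F using Finset.induction_on with
    | empty => simp
    | insert i F hi ih =>
      rw [sum_insert hi, card_insert_of_notMem hi, add_comm]
      have := mem_product.1 (hv i)
      have h1 := hD (∑ i ∈ F, ((v i).1 - (v i).2)) _ this.1 _ this.2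
      have h2 := abs_sub_le (D (∑ i ∈ F, ((v i).1 - (v i).2) + ((v i).1 - (v i).2)))
        (D (∑ i ∈ F, ((v i).1 - (v i).2))) (D 0)
      push_cast
      linarith
  simpa using h univ

variable {G : Type*} [AddCommGroup G] [Fintype G]

lemma AddChar.norm_sum_apply_neg (A : Finset G) (γ : AddChar G ℂ) :
    ‖∑ a ∈ A, γ (-a)‖ = ‖∑ a ∈ A, γ a‖ := by
  rw [← Complex.norm_conj, map_sum]
  simp_rw [AddChar.map_neg_eq_conj, Complex.conj_conj]

lemma AddChar.norm_sum_apply_le (A : Finset G) (γ : AddChar G ℂ) : ‖∑ a ∈ A, γ a‖ ≤ A.card := by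
  refine (norm_sum_le _ _).trans ?_
  simp [AddChar.norm_apply]

/-- Parseval's identity for the indicator function of a set. -/
lemma AddChar.sum_norm_sum_sq (A : Finset G) :
    ∑ γ : AddChar G ℂ, ‖∑ a ∈ A, γ a‖ ^ 2 = Fintype.card G * A.card := by
  classical
  have h : ∀ γ : AddChar G ℂ, ((‖∑ a ∈ A, γ a‖ ^ 2 : ℝ) : ℂ) = ∑ a ∈ A, ∑ b ∈ A, γ (a - b) := by
    intro γ
    rw [Complex.ofReal_pow, ← Complex.mul_conj', map_sum, sum_mul_sum]
    refine sum_congr rfl fun a _ => sum_congr rfl fun b _ => ?_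
    rw [sub_eq_add_neg, AddChar.map_add_eq_mul, AddChar.map_neg_eq_conj]
  have h2 : ((∑ γ : AddChar G ℂ, ‖∑ a ∈ A, γ a‖ ^ 2 : ℝ) : ℂ) =
      ((Fintype.card G * A.card : ℝ) : ℂ) := by
    rw [Complex.ofReal_sum]
    simp_rw [h]
    rw [sum_comm]
    have : ∀ a ∈ A, ∑ γ : AddChar G ℂ, ∑ b ∈ A, γ (a - b) = Fintype.card G := by
      intro a ha
      rw [sum_comm]
      simp_rw [AddChar.sum_apply_eq_ite, sub_eq_zero]
      simp [ha]
    rw [sum_congr rfl this]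
    simp [mul_comm]
  exact_mod_cast h2

lemma AddChar.sum_norm_mul_norm_le (A₁ A₂ : Finset G) :
    ∑ γ : AddChar G ℂ, ‖∑ a ∈ A₁, γ a‖ * ‖∑ a ∈ A₂, γ a‖ ≤
      Fintype.card G * √(A₁.card * A₂.card) := by
  refine (Real.sum_mul_le_sqrt_mul_sqrt _ _ _).trans (le_of_eq ?_)
  rw [AddChar.sum_norm_sum_sq, AddChar.sum_norm_sum_sq, ← Real.sqrt_mul (by positivity),
    show (Fintype.card G * A₁.card * (Fintype.card G * A₂.card) : ℝ) =
      Fintype.card G ^ 2 * (A₁.card * A₂.card) by ring, Real.sqrt_mul (by positivity),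
    Real.sqrt_sq (by positivity)]

variable [DecidableEq G]

/-- Fourier inversion for the representation function. -/
lemma card_mul_repCount (A₁ A₂ : Finset G) (z : G) :
    (Fintype.card G : ℂ) * repCount A₁ A₂ z =
      ∑ γ : AddChar G ℂ, γ z * ((∑ a ∈ A₁, γ (-a)) * ∑ a ∈ A₂, γ a) := by
  have h : ∀ γ : AddChar G ℂ, γ z * ((∑ a ∈ A₁, γ (-a)) * ∑ a ∈ A₂, γ a) =
      ∑ a ∈ A₂, ∑ b ∈ A₁, γ (z + a - b) := by
    intro γ
    rw [sum_mul_sum, sum_comm, mul_sum]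
    refine sum_congr rfl fun a _ => ?_
    rw [mul_sum]
    refine sum_congr rfl fun b _ => ?_
    rw [sub_eq_add_neg, AddChar.map_add_eq_mul, AddChar.map_add_eq_mul]
    ring
  simp_rw [h]
  rw [sum_comm, repCount, card_filter, Nat.cast_sum, mul_sum]
  refine sum_congr rfl fun a _ => ?_
  rw [sum_comm]
  simp_rw [AddChar.sum_apply_eq_ite, sub_eq_zero]
  simp

/-- The representation function averaged over `U + A + k (T - T) + s`, up to normalisation. -/
def smoothedRepCount (A₁ A₂ U A T : Finset G) (k : ℕ) (s : G) : ℝ :=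
  ∑ v ∈ Fintype.piFinset (fun _ : Fin k => T ×ˢ T), ∑ u ∈ U, ∑ a ∈ A,
    (repCount A₁ A₂ (u + a + ∑ i, ((v i).1 - (v i).2) + s) : ℝ)

/-- Smoothing by k copies of T - T contributes the factor |∑_{t ∈ T} γ t|^{2k}, which suppresses
every γ outside the large spectrum of `T`. -/
lemma card_mul_smoothedRepCount (A₁ A₂ U A T : Finset G) (k : ℕ) (s : G) :
    (Fintype.card G : ℂ) * smoothedRepCount A₁ A₂ U A T k s =
      ∑ γ : AddChar G ℂ, ((∑ a ∈ A₁, γ (-a)) * ∑ a ∈ A₂, γ a) *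
        ((∑ u ∈ U, γ u) * (∑ a ∈ A, γ a) * ((∑ t ∈ T, γ t) * ∑ t ∈ T, γ (-t)) ^ k) * γ s := by
  have hγ : ∀ γ : AddChar G ℂ, ∑ v ∈ Fintype.piFinset (fun _ : Fin k => T ×ˢ T),
      ∑ u ∈ U, ∑ a ∈ A, γ (u + a + ∑ i, ((v i).1 - (v i).2) + s) =
      (∑ u ∈ U, γ u) * (∑ a ∈ A, γ a) * ((∑ t ∈ T, γ t) * ∑ t ∈ T, γ (-t)) ^ k * γ s := by
    intro γ
    have h1 : ((∑ t ∈ T, γ t) * ∑ t ∈ T, γ (-t)) ^ k =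
        ∑ v ∈ Fintype.piFinset (fun _ : Fin k => T ×ˢ T), γ (∑ i, ((v i).1 - (v i).2)) := by
      simp_rw [AddChar.apply_sum_eq_prod]
      rw [Finset.sum_prod_piFinset (T ×ˢ T) (fun (_ : Fin k) q => γ (q.1 - q.2)), prod_const,
        card_univ, Fintype.card_fin, sum_product, sum_mul_sum]
      simp_rw [sub_eq_add_neg, AddChar.map_add_eq_mul]
    rw [h1, mul_sum, sum_mul]
    refine sum_congr rfl fun v _ => ?_
    rw [sum_mul_sum, sum_mul, sum_mul]
    refine sum_congr rfl fun u _ => ?_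
    rw [sum_mul, sum_mul]
    refine sum_congr rfl fun a _ => ?_
    rw [AddChar.map_add_eq_mul, AddChar.map_add_eq_mul, AddChar.map_add_eq_mul]
  have hcast : (Fintype.card G : ℂ) * smoothedRepCount A₁ A₂ U A T k s =
      ∑ v ∈ Fintype.piFinset (fun _ : Fin k => T ×ˢ T), ∑ u ∈ U, ∑ a ∈ A,
        (Fintype.card G : ℂ) * repCount A₁ A₂ (u + a + ∑ i, ((v i).1 - (v i).2) + s) := by
    simp only [smoothedRepCount, Complex.ofReal_sum, Complex.ofReal_natCast, mul_sum]
  rw [hcast]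
  simp_rw [card_mul_repCount]
  calc _ = ∑ γ : AddChar G ℂ, ∑ v ∈ Fintype.piFinset (fun _ : Fin k => T ×ˢ T),
          ∑ u ∈ U, ∑ a ∈ A, γ (u + a + ∑ i, ((v i).1 - (v i).2) + s) *
            ((∑ a ∈ A₁, γ (-a)) * ∑ a ∈ A₂, γ a) := by
        rw [sum_comm]
        conv_rhs => rw [sum_comm]
        rw [sum_comm]
        refine sum_congr rfl fun v _ => ?_
        conv_rhs => rw [sum_comm]
        refine sum_congr rfl fun u _ => ?_
        conv_rhs => rw [sum_comm]
    _ = _ := by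
        refine sum_congr rfl fun γ _ => ?_
        simp_rw [← sum_mul]
        rw [hγ]
        ring

/-- The smoothed representation function is almost invariant under shifts which almost annihilate
the large spectrum of `T`. -/
lemma abs_smoothedRepCount_sub_le (A₁ A₂ U A T : Finset G) {k : ℕ} {ν : ℝ} {s : G}
    (hν : 2 / 4 ^ k ≤ ν)
    (hs : ∀ γ : AddChar G ℂ, (T.card : ℝ) / 2 ≤ ‖∑ t ∈ T, γ t‖ → ‖γ s - 1‖ ≤ ν) :
    |smoothedRepCount A₁ A₂ U A T k s - smoothedRepCount A₁ A₂ U A T k 0| ≤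
      U.card * A.card * ((T.card : ℝ) ^ 2) ^ k * ν * √(A₁.card * A₂.card) := by
  have hG0 : (0 : ℝ) < Fintype.card G := by exact_mod_cast Fintype.card_pos
  have hν0 : 0 ≤ ν := le_trans (by positivity) hν
  set Q : ℝ := U.card * A.card * ((T.card : ℝ) ^ 2) ^ k * ν with hQ
  have hterm : ∀ γ : AddChar G ℂ, ‖((∑ a ∈ A₁, γ (-a)) * ∑ a ∈ A₂, γ a) *
        ((∑ u ∈ U, γ u) * (∑ a ∈ A, γ a) * ((∑ t ∈ T, γ t) * ∑ t ∈ T, γ (-t)) ^ k) *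
          (γ s - 1)‖ ≤ ‖∑ a ∈ A₁, γ a‖ * ‖∑ a ∈ A₂, γ a‖ * Q := by
    intro γ
    simp only [norm_mul, norm_pow, AddChar.norm_sum_apply_neg]
    rw [mul_assoc (_ * _)]
    refine mul_le_mul_of_nonneg_left ?_ (by positivity)
    have h1 : (‖∑ t ∈ T, γ t‖ * ‖∑ t ∈ T, γ t‖) ^ k * ‖γ s - 1‖ ≤ ((T.card : ℝ) ^ 2) ^ k * ν := by
      rw [← sq]
      by_cases hlarge : (T.card : ℝ) / 2 ≤ ‖∑ t ∈ T, γ t‖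
      · have := AddChar.norm_sum_apply_le T γ
        have := hs γ hlarge
        gcongr
      -- Off the large spectrum only |γ s - 1| ≤ 2 is known, but the damping factor gains 4^{-k}.
      · push Not at hlarge
        have h2 : ‖γ s - 1‖ ≤ 2 := by
          refine (norm_sub_le _ _).trans ?_
          rw [AddChar.norm_apply, norm_one]; norm_num
        calc (‖∑ t ∈ T, γ t‖ ^ 2) ^ k * ‖γ s - 1‖ ≤ (((T.card : ℝ) / 2) ^ 2) ^ k * 2 := by gcongr
          _ = ((T.card : ℝ) ^ 2) ^ k * (2 / 4 ^ k) := by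
              rw [div_pow, div_pow]; norm_num; ring
          _ ≤ _ := by gcongr
    calc _ = ‖∑ u ∈ U, γ u‖ * ‖∑ a ∈ A, γ a‖ *
          ((‖∑ t ∈ T, γ t‖ * ‖∑ t ∈ T, γ t‖) ^ k * ‖γ s - 1‖) := by ring
      _ ≤ U.card * A.card * (((T.card : ℝ) ^ 2) ^ k * ν) := by
          refine mul_le_mul (mul_le_mul (AddChar.norm_sum_apply_le U γ)
            (AddChar.norm_sum_apply_le A γ) (norm_nonneg _) (by positivity)) h1 (by positivity)
            (by positivity)
      _ = Q := by rw [hQ]; ring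
  have hkey : (Fintype.card G : ℝ) *
      |smoothedRepCount A₁ A₂ U A T k s - smoothedRepCount A₁ A₂ U A T k 0| ≤
      Fintype.card G * (Q * √(A₁.card * A₂.card)) := by
    calc (Fintype.card G : ℝ) *
          |smoothedRepCount A₁ A₂ U A T k s - smoothedRepCount A₁ A₂ U A T k 0|
        = ‖(Fintype.card G : ℂ) * smoothedRepCount A₁ A₂ U A T k s -
            (Fintype.card G : ℂ) * smoothedRepCount A₁ A₂ U A T k 0‖ := by
          rw [← mul_sub, norm_mul, ← Complex.ofReal_sub, Complex.norm_real, Complex.norm_natCast,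
            Real.norm_eq_abs]
      _ = ‖∑ γ : AddChar G ℂ, ((∑ a ∈ A₁, γ (-a)) * ∑ a ∈ A₂, γ a) *
            ((∑ u ∈ U, γ u) * (∑ a ∈ A, γ a) * ((∑ t ∈ T, γ t) * ∑ t ∈ T, γ (-t)) ^ k) *
              (γ s - 1)‖ := by
          rw [card_mul_smoothedRepCount, card_mul_smoothedRepCount, ← sum_sub_distrib]
          congr 1
          refine sum_congr rfl fun γ _ => ?_
          rw [AddChar.map_zero_eq_one, mul_sub]
      _ ≤ ∑ γ : AddChar G ℂ, ‖∑ a ∈ A₁, γ a‖ * ‖∑ a ∈ A₂, γ a‖ * Q :=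
          (norm_sum_le _ _).trans (sum_le_sum fun γ _ => hterm γ)
      _ ≤ Fintype.card G * √(A₁.card * A₂.card) * Q := by
          rw [← sum_mul]
          exact mul_le_mul_of_nonneg_right (AddChar.sum_norm_mul_norm_le A₁ A₂) (by positivity)
      _ = _ := by ring
  exact le_of_mul_le_mul_left hkey hG0

/-- Averaging argument: if the smoothed representation function is large throughout `S`, then some
translate of `S` has large average representation function. -/
lemma exists_le_sum_repCount {A₁ A₂ U A T S : Finset G} {k : ℕ} {X : ℝ} (hU : U.Nonempty)
    (hA : A.Nonempty) (hT : T.Nonempty)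
    (h : ∀ s ∈ S, U.card * A.card * ((T.card : ℝ) ^ 2) ^ k * X ≤
      smoothedRepCount A₁ A₂ U A T k s) :
    ∃ z, S.card * X ≤ ∑ s ∈ S, (repCount A₁ A₂ (z + s) : ℝ) := by
  by_contra! hcon
  have h1 := sum_le_sum h
  rw [sum_const, nsmul_eq_mul] at h1
  unfold smoothedRepCount at h1
  rw [sum_comm] at h1
  have h2 : ∑ v ∈ Fintype.piFinset (fun _ : Fin k => T ×ˢ T), ∑ s ∈ S, ∑ u ∈ U, ∑ a ∈ A,
      (repCount A₁ A₂ (u + a + ∑ i, ((v i).1 - (v i).2) + s) : ℝ) <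
      ∑ v ∈ Fintype.piFinset (fun _ : Fin k => T ×ˢ T), ∑ u ∈ U, ∑ a ∈ A, S.card * X := by
    refine sum_lt_sum_of_nonempty (Fintype.piFinset_nonempty.2 fun _ => hT.product hT)
      fun v _ => ?_
    rw [sum_comm]
    refine sum_lt_sum_of_nonempty hU fun u _ => ?_
    rw [sum_comm]
    exact sum_lt_sum_of_nonempty hA fun a _ => hcon _
  simp only [sum_const, Fintype.card_piFinset_const, card_product, nsmul_eq_mul] at h2
  push_cast at h2
  have h3 : ((T.card : ℝ) * T.card) ^ k * (U.card * (A.card * (S.card * X))) =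
      S.card * (U.card * A.card * ((T.card : ℝ) ^ 2) ^ k * X) := by rw [← sq]; ring
  linarith

/-- Double counting: the sum over s equals the sum over a ∈ A₂ of the number of s ∈ S with z + a + s
∈ A₁, and some a reaches the average. -/
lemma exists_le_card_filter_add_mem {A₁ A₂ S : Finset G} (hA₂ : A₂.Nonempty) {X : ℝ} {z : G}
    (h : S.card * X ≤ ∑ s ∈ S, (repCount A₁ A₂ (z + s) : ℝ)) :
    ∃ w, S.card * X / A₂.card ≤ (S.filter fun s => w + s ∈ A₁).card := by
  have hA0 : (0 : ℝ) < A₂.card := by exact_mod_cast hA₂.card_pos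
  by_contra! hcon
  have h1 : ∑ s ∈ S, (repCount A₁ A₂ (z + s) : ℝ) =
      ∑ a ∈ A₂, ((S.filter fun s => z + a + s ∈ A₁).card : ℝ) := by
    simp_rw [repCount, card_filter, Nat.cast_sum]
    rw [sum_comm]
    simp_rw [add_right_comm]
  have h2 := sum_lt_sum_of_nonempty hA₂ fun a _ => hcon (z + a)
  rw [sum_const, nsmul_eq_mul, mul_div_cancel₀ _ hA0.ne'] at h2
  linarith

end Fourier

/-! ### From normalised convolutions to counting -/

section Conversion

lemma normInd_apply {G : Type*} [Fintype G] [DecidableEq G] (S : Finset G) (x : G) :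
    normInd S x = if x ∈ S then (Fintype.card G : ℝ) / S.card else 0 := by
  rw [normInd, Set.indicator_apply]
  simp only [mem_coe, dens]
  push_cast
  rw [inv_div]

variable {G : Type*} [AddCommGroup G] [Fintype G] [DecidableEq G]

lemma diffConvAvg_normInd (A₁ A₂ : Finset G) (z : G) :
    diffConvAvg (normInd A₁) (normInd A₂) z =
      Fintype.card G / (A₁.card * A₂.card) * repCount A₁ A₂ z := by
  have hG0 : (Fintype.card G : ℝ) ≠ 0 := by exact_mod_cast Fintype.card_ne_zero
  rw [diffConvAvg, Fintype.expect_eq_sum_div_card, ← Equiv.sum_comp (Equiv.addLeft z)]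
  simp only [Equiv.coe_addLeft, normInd_apply, add_sub_cancel_left]
  have h : ∀ a : G, (if z + a ∈ A₁ then (Fintype.card G : ℝ) / A₁.card else 0) *
      (if a ∈ A₂ then (Fintype.card G : ℝ) / A₂.card else 0) =
      if a ∈ A₂ then (if z + a ∈ A₁ then
        (Fintype.card G : ℝ) / A₁.card * (Fintype.card G / A₂.card) else 0) else 0 := by
    intro a
    split_ifs <;> simp
  simp_rw [h]
  rw [← sum_filter, filter_mem_eq_inter, univ_inter, ← sum_filter, sum_const, nsmul_eq_mul,
    repCount]
  field_simp

lemma expect_mul_convAvg_normInd (F : G → ℝ) (S₁ S₂ : Finset G) :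
    𝔼 z, F z * convAvg (normInd S₁) (normInd S₂) z =
      (∑ u ∈ S₁, ∑ b ∈ S₂, F (u + b)) / (S₁.card * S₂.card) := by
  have hG0 : (Fintype.card G : ℝ) ≠ 0 := by exact_mod_cast Fintype.card_ne_zero
  have h : ∀ z, F z * convAvg (normInd S₁) (normInd S₂) z =
      ∑ u ∈ S₁, (Fintype.card G / (S₁.card * S₂.card) : ℝ) * (if z - u ∈ S₂ then F z else 0) := by
    intro z
    rw [convAvg, Fintype.expect_eq_sum_div_card]
    simp only [normInd_apply, ite_mul, zero_mul]
    rw [← sum_filter, filter_mem_eq_inter, univ_inter, mul_div_assoc', mul_sum, sum_div]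
    refine sum_congr rfl fun u _ => ?_
    split_ifs
    · field_simp
    · simp
  rw [Fintype.expect_eq_sum_div_card]
  simp_rw [h]
  rw [sum_comm, sum_div, sum_div]
  refine sum_congr rfl fun u _ => ?_
  rw [← mul_sum, ← Equiv.sum_comp (Equiv.addLeft u)]
  simp only [Equiv.coe_addLeft, add_sub_cancel_left]
  rw [← sum_filter, filter_mem_eq_inter, univ_inter]
  field_simp

lemma convAvg_normInd (A S : Finset G) (hS : ∀ s ∈ S, -s ∈ S) (w : G) :
    convAvg (normInd A) (normInd S) w =
      Fintype.card G / (A.card * S.card) * (S.filter fun s => w + s ∈ A).card := by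
  have hG0 : (Fintype.card G : ℝ) ≠ 0 := by exact_mod_cast Fintype.card_ne_zero
  have hS' : ∀ s, -s ∈ S ↔ s ∈ S := fun s => ⟨fun h => by simpa using hS _ h, hS s⟩
  rw [convAvg, Fintype.expect_eq_sum_div_card, ← Equiv.sum_comp (Equiv.addLeft w)]
  simp only [Equiv.coe_addLeft, normInd_apply, sub_add_cancel_left, hS']
  have h : ∀ a : G, (if w + a ∈ A then (Fintype.card G : ℝ) / A.card else 0) *
      (if a ∈ S then (Fintype.card G : ℝ) / S.card else 0) =
      if a ∈ S then (if w + a ∈ A then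
        (Fintype.card G : ℝ) / A.card * (Fintype.card G / S.card) else 0) else 0 := by
    intro a
    split_ifs <;> simp
  simp_rw [h]
  rw [← sum_filter, filter_mem_eq_inter, univ_inter, ← sum_filter, sum_const, nsmul_eq_mul]
  field_simp

/-- A lower bound for the weighted `L^p` norm of `μ_{A₁} ∘ μ_{A₂}` in terms of moments of the
representation function. -/
lemma le_sum_repCount_pow_of_le_wLpNorm {A₁ A₂ S₁ S₂ : Finset G} {p : ℕ} (hp : 0 < p)
    (hA₁ : A₁.Nonempty) (hA₂ : A₂.Nonempty) (hS₁ : S₁.Nonempty) (hS₂ : S₂.Nonempty) {M : ℝ}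
    (hM : 0 ≤ M)
    (h : Fintype.card G / (A₁.card * A₂.card) * M ≤
      wLpNorm p (convAvg (normInd S₁) (normInd S₂)) (diffConvAvg (normInd A₁) (normInd A₂))) :
    S₁.card * S₂.card * M ^ p ≤
      ∑ u ∈ S₁, ∑ b ∈ S₂, (repCount A₁ A₂ (u + b) : ℝ) ^ p := by
  have h1 : (0 : ℝ) < A₁.card := by exact_mod_cast hA₁.card_pos
  have h2 : (0 : ℝ) < A₂.card := by exact_mod_cast hA₂.card_pos
  have h3 : (0 : ℝ) < S₁.card := by exact_mod_cast hS₁.card_pos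
  have h4 : (0 : ℝ) < S₂.card := by exact_mod_cast hS₂.card_pos
  have hG0 : (0 : ℝ) < Fintype.card G := by exact_mod_cast Fintype.card_pos
  set q : ℝ := Fintype.card G / (A₁.card * A₂.card) with hq
  have hq0 : 0 < q := by positivity
  rw [wLpNorm, expect_mul_convAvg_normInd (fun z => |diffConvAvg (normInd A₁) (normInd A₂) z| ^
    (p : ℝ))] at h
  simp only [diffConvAvg_normInd, Real.rpow_natCast] at h
  rw [← hq] at h
  have hpow := pow_le_pow_left₀ (by positivity) h p
  rw [← Real.rpow_natCast (_ ^ (1 / (p : ℝ))), ← Real.rpow_mul (by positivity),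
    one_div_mul_cancel (by positivity), Real.rpow_one, le_div_iff₀ (by positivity), mul_pow] at hpow
  have hF : ∑ u ∈ S₁, ∑ b ∈ S₂, |q * (repCount A₁ A₂ (u + b) : ℝ)| ^ p =
      q ^ p * ∑ u ∈ S₁, ∑ b ∈ S₂, (repCount A₁ A₂ (u + b) : ℝ) ^ p := by
    simp_rw [mul_sum]
    refine sum_congr rfl fun u _ => sum_congr rfl fun b _ => ?_
    rw [abs_of_nonneg (by positivity), mul_pow]
  rw [hF, mul_assoc] at hpow
  have := le_of_mul_le_mul_left hpow (by positivity)
  linarith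

end Conversion

/-! ### Annihilating the large spectrum; sifting joined with almost periodicity -/

section Core

variable {G : Type*} [AddCommGroup G] [Fintype G]

lemma sum_mem_bohr {ι : Type*} {Γ : Finset (AddChar G ℂ)} {r : ℝ} (F : Finset ι) {v : ι → G}
    (hv : ∀ i ∈ F, v i ∈ bohr Γ r) : ∑ i ∈ F, v i ∈ bohr Γ (F.card * r) := by
  classical
  induction F using Finset.induction_on with
  | empty => simpa using zero_mem_bohr Γ le_rfl
  | insert i F hi ih =>
    rw [sum_insert hi, card_insert_of_notMem hi, Nat.cast_add, Nat.cast_one, add_comm (F.card : ℝ),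
      add_mul, one_mul]
    exact add_mem_bohr (hv i (mem_insert_self _ _)) (ih fun j hj => hv j (mem_insert_of_mem hj))

/-- The bound for a slightly enlarged regular Bohr set. -/
lemma IsRegularBohr.card_enlarged_le {Γ : Finset (AddChar G ℂ)} {r : ℝ} (h : IsRegularBohr Γ r)
    (hΓ : Γ.Nonempty) :
    ((bohr Γ ((1 + 1 / (100 * (Γ.card : ℝ))) * r)).card : ℝ) ≤ 2 * (bohr Γ r).card := by
  have hd : (0 : ℝ) < Γ.card := by exact_mod_cast hΓ.card_pos
  refine (h (1 / (100 * (Γ.card : ℝ))) (by positivity) le_rfl).2.2.trans (le_of_eq ?_)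
  congr 1
  field_simp
  norm_num

/-- The Bohr set generated by all characters is trivial for small widths. -/
lemma bohr_univ_eq_singleton {r : ℝ} (h0 : 0 ≤ r) (h1 : r < 1) :
    bohr (univ : Finset (AddChar G ℂ)) r = {0} := by
  classical
  ext x
  rw [mem_singleton]
  constructor
  · intro hx
    by_contra hne
    have hsum : ∑ γ : AddChar G ℂ, γ x = 0 := AddChar.sum_apply_eq_zero_iff_ne_zero.2 hne
    have hpos : 0 < ∑ γ : AddChar G ℂ, (γ x).re := by
      refine sum_pos (fun γ _ => ?_) ⟨0, mem_univ _⟩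
      have h2 := (Complex.abs_re_le_norm (γ x - 1)).trans (mem_bohr.1 hx γ (mem_univ _))
      rw [Complex.sub_re, Complex.one_re, abs_le] at h2
      linarith
    rw [← Complex.re_sum, hsum, Complex.zero_re] at hpos
    exact lt_irrefl _ hpos
  · rintro rfl
    exact zero_mem_bohr _ h0

/-- All the dilates tested by regularity have width below 1, so each of them is {0}. -/
lemma isRegularBohr_univ : IsRegularBohr (univ : Finset (AddChar G ℂ)) (1 / 4) := by
  intro δ hδ hδ1
  have hc : (1 : ℝ) ≤ (univ : Finset (AddChar G ℂ)).card := by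
    exact_mod_cast card_pos.2 ⟨0, mem_univ _⟩
  have hδ2 : δ ≤ 1 / 100 := by
    refine hδ1.trans (one_div_le_one_div_of_le (by norm_num) (by linarith))
  rw [bohr_univ_eq_singleton (by norm_num) (by norm_num), bohr_univ_eq_singleton (by linarith)
    (by linarith), bohr_univ_eq_singleton (by linarith) (by linarith)]
  have : 0 ≤ δ * ((univ : Finset (AddChar G ℂ)).card : ℝ) := by positivity
  simp only [card_singleton, Nat.cast_one, mul_one]
  refine ⟨by linarith, le_rfl, by linarith⟩

/-- A Bohr set annihilating the large spectrum of a dense subset `T` of a regular Bohr set. -/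
lemma exists_bohr_annihilating_spectrum {Γ : Finset (AddChar G ℂ)} (hΓ : Γ.Nonempty) {r ν : ℝ}
    (hr : 0 ≤ r) (hreg : IsRegularBohr Γ r) {T : Finset G} (hTsub : T ⊆ bohr Γ r)
    (hT : T.Nonempty) (hν : 0 < ν) (hν8 : ν ≤ 8) {N : ℕ} (hN0 : 0 < N)
    (hN : 8 * Real.log (4 * (bohr Γ r).card / T.card) < N)
    (hNG : N ≤ Fintype.card (AddChar G ℂ)) :
    ∃ (Δ : Finset (AddChar G ℂ)) (r' : ℝ), Δ.card = N ∧ 0 ≤ r' ∧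
      min (ν * r / (1280000 * (Γ.card : ℝ) ^ 2 * N)) (ν / (2 * N)) / 16 ≤ r' ∧
      IsRegularBohr (Γ ∪ Δ) r' ∧ ∀ s ∈ bohr (Γ ∪ Δ) r', ∀ γ : AddChar G ℂ,
        (T.card : ℝ) / 2 ≤ ‖∑ t ∈ T, γ t‖ → ‖γ s - 1‖ ≤ ν := by
  have hd : (1 : ℝ) ≤ Γ.card := by exact_mod_cast hΓ.card_pos
  have hN1 : (0 : ℝ) < N := by exact_mod_cast hN0
  have hT0 : (0 : ℝ) < T.card := by exact_mod_cast hT.card_pos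
  set d : ℝ := (Γ.card : ℝ) with hddef
  -- With N·r₁ ≤ r/(100d), subtracting N elements of `bohr Γ r₁` from `T` stays in a dilate whose
  -- size regularity bounds by 2|bohr Γ r|.
  obtain ⟨r₁, hr₁l, hr₁u, hreg₁⟩ := exists_isRegularBohr hΓ (R := r / (100 * d * N)) (by positivity)
  have hr₁0 : 0 ≤ r₁ := le_trans (by positivity) hr₁l
  have hB := card_bohr_pos Γ hr₁0
  have hB0 : (0 : ℝ) < (bohr Γ r₁).card := by exact_mod_cast hB
  have hsumset : ∀ x ∈ T, ∀ v : Fin N → G, (∀ i, v i ∈ bohr Γ r₁) →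
      x - ∑ i, v i ∈ bohr Γ ((1 + 1 / (100 * d)) * r) := by
    intro x hx v hv
    have h1 := sum_mem_bohr univ fun i _ => hv i
    rw [card_univ, Fintype.card_fin] at h1
    refine bohr_mono Γ ?_ (sub_mem_bohr (hTsub hx) h1)
    have h2 : N * r₁ ≤ N * (r / (100 * d * N)) := by gcongr
    have h3 : N * (r / (100 * d * N)) = 1 / (100 * d) * r := by field_simp
    linarith
  have hBp := hreg.card_enlarged_le hΓ
  rw [← hddef] at hBp
  have hBp0 : (0 : ℝ) < (bohr Γ ((1 + 1 / (100 * d)) * r)).card := by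
    exact_mod_cast card_bohr_pos Γ (by positivity)
  obtain ⟨Λ, hΛN, hΛ⟩ := exists_card_le_forall_spectrum (card_pos.1 hB) hT hsumset (by
    refine lt_of_le_of_lt ?_ hN
    refine mul_le_mul_of_nonneg_left (Real.log_le_log (by positivity) ?_) (by norm_num)
    refine div_le_div_of_nonneg_right ?_ hT0.le
    linarith)
  -- Padding to exactly N elements makes N the rank in both the rank bound and the width bound.
  obtain ⟨Δ, hΛΔ, hΔ⟩ := exists_superset_card_eq hΛN hNG
  -- The budget ν is split evenly: a character in the large spectrum of `bohr Γ r₁` moves by at most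
  -- 400κd = ν/2, and the characters of Λ by at most N · ν/(2N) = ν/2 in total.
  set κ : ℝ := ν / (800 * d) with hκ
  have hκ0 : 0 < κ := by positivity
  have hκd : κ ≤ 1 / (100 * d) := by
    rw [hκ, div_le_div_iff₀ (by positivity) (by positivity)]
    nlinarith
  obtain ⟨r', hr'l, hr'u, hreg'⟩ := exists_isRegularBohr (Γ := Γ ∪ Δ) (hΓ.mono subset_union_left)
    (R := min (κ * r₁) (ν / (2 * N))) (le_min (by positivity) (by positivity))
  have hr'0 : 0 ≤ r' := le_trans (div_nonneg (le_min (by positivity) (by positivity))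
    (by norm_num)) hr'l
  refine ⟨Δ, r', hΔ, hr'0, le_trans ?_ hr'l, hreg', ?_⟩
  · gcongr
    calc ν * r / (1280000 * d ^ 2 * N) = κ * (r / (100 * d * N) / 16) := by
          rw [hκ]; field_simp; ring
      _ ≤ κ * r₁ := by gcongr
  · intro s hs γ hγ
    obtain ⟨ψ, hψ, hψs⟩ := hΛ γ hγ
    have hsΓ : s ∈ bohr Γ (κ * r₁) :=
      bohr_mono Γ (hr'u.trans (min_le_left _ _)) (bohr_anti subset_union_left r' hs)
    have h1 := hreg₁.norm_sub_one_mul_norm_sum_le hκ0 hκd ψ hsΓ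
    have h2 : ‖ψ s - 1‖ * ((bohr Γ r₁).card / 2) ≤ 200 * κ * d * (bohr Γ r₁).card :=
      le_trans (by gcongr) h1
    have h3 : 200 * κ * d = ν / 4 := by rw [hκ]; field_simp; norm_num
    rw [h3] at h2
    have h4 : ‖ψ s - 1‖ ≤ ν / 2 := by
      refine le_of_mul_le_mul_right ?_ (half_pos hB0)
      linarith
    have h5 : ∑ χ ∈ Λ, ‖χ s - 1‖ ≤ ν / 2 := by
      calc ∑ χ ∈ Λ, ‖χ s - 1‖ ≤ ∑ χ ∈ Λ, ν / (2 * N) := by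
            refine sum_le_sum fun χ hχ => ?_
            exact (mem_bohr.1 hs χ (mem_union_right _ (hΛΔ hχ))).trans
              (hr'u.trans (min_le_right _ _))
        _ = Λ.card * (ν / (2 * N)) := by rw [sum_const, nsmul_eq_mul]
        _ ≤ N * (ν / (2 * N)) := by gcongr
        _ = ν / 2 := by field_simp
    linarith [hψs s]

variable [DecidableEq G]

/-- Sifting and almost periodicity combined: a dense set `T` of a small Bohr set such that the
representation function smoothed by `T - T` remains large, and a point where the representation
function is large. -/
lemma exists_smoothedRepCount_ge {Γ₁ Γ : Finset (AddChar G ℂ)} {ρ₁ ρ r : ℝ}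
    (hΓ₁ : Γ₁.Nonempty) (hΓ : Γ.Nonempty) (hcard : Γ₁.card = Γ.card) (hρ₁ : 0 ≤ ρ₁) (hρ : 0 ≤ ρ)
    (hreg₁ : IsRegularBohr Γ₁ ρ₁) (hreg : IsRegularBohr Γ ρ)
    (hsub : bohr Γ ρ ⊆ bohr Γ₁ (1 / (200 * (Γ.card : ℝ)) * ρ₁))
    (hr : 0 ≤ r) (hrρ : r ≤ 1 / (100 * (Γ.card : ℝ)) * ρ)
    {A₁ A₂ : Finset G} {x : G} {p k l m : ℕ} {n M τ δ η : ℝ} (hn : 0 < n)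
    (hA₁ : A₁.Nonempty) (hA₂ : A₂.Nonempty)
    (hM : A₁.card * A₂.card / n ≤ M) (hτ : 0 ≤ τ) (hδ : 0 < δ) (hδ1 : δ < 1)
    (hτM : τ ^ p ≤ δ / 4 * M ^ p)
    (hmom : (bohr Γ₁ ρ₁).card * (translateBy (bohr Γ ρ) x).card * M ^ p ≤
      ∑ u ∈ bohr Γ₁ ρ₁, ∑ b ∈ translateBy (bohr Γ ρ) x, (repCount A₁ A₂ (u + b) : ℝ) ^ p)
    (hl : 0 < l) (hm : 0 < m) (hη : 0 ≤ η)
    (hηl : 32 * (24 * m / l : ℝ) ^ m ≤ (A₁.card / n) ^ p * η ^ (2 * m)) :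
    (∃ z, τ ≤ repCount A₁ A₂ z) ∧ ∃ U A T : Finset G, U.Nonempty ∧ A.Nonempty ∧ T.Nonempty ∧
      T ⊆ bohr Γ r ∧ ((bohr Γ r).card : ℝ) * ((A₂.card / n) ^ p / 8) ^ l ≤ 2 * T.card ∧
      U.card * A.card * ((T.card : ℝ) ^ 2) ^ k * (τ * (1 - δ - k * η)) ≤
        smoothedRepCount A₁ A₂ U A T k 0 := by
  have hA₁0 : (0 : ℝ) < A₁.card := by exact_mod_cast hA₁.card_pos
  have hA₂0 : (0 : ℝ) < A₂.card := by exact_mod_cast hA₂.card_pos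
  have hd : (0 : ℝ) < Γ.card := by exact_mod_cast hΓ.card_pos
  have hB₁ : (bohr Γ₁ ρ₁).Nonempty := ⟨0, zero_mem_bohr _ hρ₁⟩
  have hB₁0 : (0 : ℝ) < (bohr Γ₁ ρ₁).card := by exact_mod_cast hB₁.card_pos
  have hB : (bohr Γ ρ).Nonempty := ⟨0, zero_mem_bohr _ hρ⟩
  have hB0 : (0 : ℝ) < (bohr Γ ρ).card := by exact_mod_cast hB.card_pos
  obtain ⟨U, hU, A, hA, hUcard, hAcard, hbad⟩ := exists_sift A₁ A₂ (bohr Γ₁ ρ₁)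
    (translateBy (bohr Γ ρ) x) p hn hδ hA₁ hA₂ hB₁ (hB.map) hM hτ hτM hmom
  rw [card_translateBy] at hAcard
  have hU0 : (0 : ℝ) < U.card := lt_of_lt_of_le (by positivity) hUcard
  have hA0 : (0 : ℝ) < A.card := lt_of_lt_of_le (by positivity) hAcard
  have hUne : U.Nonempty := card_pos.1 (by exact_mod_cast hU0)
  have hAne : A.Nonempty := card_pos.1 (by exact_mod_cast hA0)
  -- The sums u + a lie in `Z`. Cutting `f` off outside `Z` confines y to `Y`, whose dilation factor
  -- 1 + 2/(200d) is the largest one that regularity controls.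
  set Z := translateBy (bohr Γ₁ ((1 + 1 / (200 * (Γ.card : ℝ))) * ρ₁)) x with hZ
  set Y := bohr Γ₁ ((1 + 1 / (100 * (Γ₁.card : ℝ))) * ρ₁) with hY
  set W := translateBy (bohr Γ ((1 + 1 / (100 * (Γ.card : ℝ))) * ρ)) x with hW
  let f : G → ℝ := fun z => if τ ≤ repCount A₁ A₂ z ∧ z ∈ Z then 1 else 0
  have hf0 : ∀ z, 0 ≤ f z := fun z => by simp only [f]; split_ifs <;> norm_num
  have hf1 : ∀ z, f z ≤ 1 := fun z => by simp only [f]; split_ifs <;> norm_num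
  have hfτ : ∀ z, τ * f z ≤ repCount A₁ A₂ z := fun z => by
    simp only [f]
    split_ifs with h
    · linarith [h.1]
    · simp
  have hUA : ∀ u ∈ U, ∀ a ∈ A, u + a ∈ Z := by
    intro u hu a ha
    rw [hZ, mem_translateBy, add_sub_assoc, add_mul, one_mul]
    exact add_mem_bohr (hU hu) (hsub (mem_translateBy.1 (hA ha)))
  have hsupp : ∀ y, ∀ a ∈ A, f (y + a) ≠ 0 → y ∈ Y := by
    intro y a ha hne
    have hz : y + a ∈ Z := by
      by_contra hz
      exact hne (by simp only [f]; rw [if_neg (fun h => hz h.2)])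
    have h1 := mem_translateBy.1 hz
    have h2 := hsub (mem_translateBy.1 (hA ha))
    have h3 := sub_mem_bohr h1 h2
    rw [show y + a - x - (a - x) = y by abel] at h3
    rw [hY, hcard]
    refine bohr_mono Γ₁ (le_of_eq ?_) h3
    field_simp
    ring
  have hAW : ∀ a ∈ A, ∀ t ∈ bohr Γ r, a + t ∈ W := by
    intro a ha t ht
    rw [hW, mem_translateBy, show a + t - x = (a - x) + t by abel]
    refine bohr_mono Γ ?_ (add_mem_bohr (mem_translateBy.1 (hA ha)) ht)
    linarith
  have hYcard : (Y.card : ℝ) ≤ 2 * (bohr Γ₁ ρ₁).card := hreg₁.card_enlarged_le hΓ₁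
  have hWcard : (W.card : ℝ) ≤ 2 * (bohr Γ ρ).card := by
    rw [hW, card_translateBy]; exact hreg.card_enlarged_le hΓ
  have hηl' : 4 * Y.card * (24 * m / l : ℝ) ^ m ≤ U.card * η ^ (2 * m) := by
    calc 4 * Y.card * (24 * m / l : ℝ) ^ m
        ≤ 4 * (2 * (bohr Γ₁ ρ₁).card) * (24 * m / l : ℝ) ^ m := by gcongr
      _ = (bohr Γ₁ ρ₁).card / 4 * (32 * (24 * m / l : ℝ) ^ m) := by ring
      _ ≤ (bohr Γ₁ ρ₁).card / 4 * ((A₁.card / n) ^ p * η ^ (2 * m)) := by gcongr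
      _ = ((A₁.card / n) ^ p * (bohr Γ₁ ρ₁).card / 4) * η ^ (2 * m) := by ring
      _ ≤ _ := by gcongr
  obtain ⟨T, hTsub, hTcard, hTper⟩ := exists_almost_periods A (bohr Γ r) W Y U f hAne hUne hf0 hf1
    hsupp hAW hl hm hη hηl'
  have hW0 : (0 : ℝ) < W.card := by
    rw [hW, card_translateBy]
    exact_mod_cast card_bohr_pos Γ (by positivity)
  have hTcard' : ((bohr Γ r).card : ℝ) * ((A₂.card / n) ^ p / 8) ^ l ≤ 2 * T.card := by
    have h1 : (A₂.card / n) ^ p / 8 * W.card ≤ A.card := by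
      calc (A₂.card / n) ^ p / 8 * W.card ≤ (A₂.card / n) ^ p / 8 * (2 * (bohr Γ ρ).card) := by
            gcongr
        _ = (A₂.card / n) ^ p * (bohr Γ ρ).card / 4 := by ring
        _ ≤ _ := hAcard
    have h2 : ((bohr Γ r).card : ℝ) * ((A₂.card / n) ^ p / 8) ^ l * (W.card : ℝ) ^ l ≤
        2 * T.card * (W.card : ℝ) ^ l := by
      refine le_trans ?_ hTcard
      rw [mul_assoc, ← mul_pow]
      gcongr
    exact le_of_mul_le_mul_right h2 (by positivity)
  have hTne : T.Nonempty := by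
    have h1 : (0 : ℝ) < (bohr Γ r).card := by exact_mod_cast card_bohr_pos Γ hr
    have h2 : (0 : ℝ) < 2 * T.card := lt_of_lt_of_le (by positivity) hTcard'
    exact card_pos.1 (by exact_mod_cast (by linarith : (0 : ℝ) < T.card))
  -- `D w` is the proportion of sums u + a + w in the popular part of `Z`: at least 1 - δ at w = 0
  -- by sifting, and losing at most kη after k shifts from T - T.
  set D : G → ℝ := fun w => (∑ u ∈ U, ∑ a ∈ A, f (u + a + w)) / (U.card * A.card) with hD
  have hbad' : U.card * A.card * (1 - δ) ≤ ∑ u ∈ U, ∑ a ∈ A, f (u + a) := by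
    have h1 : ∑ u ∈ U, ∑ a ∈ A, f (u + a) = ∑ u ∈ U, ∑ a ∈ A,
        (1 - if (repCount A₁ A₂ (u + a) : ℝ) < τ then (1 : ℝ) else 0) := by
      refine sum_congr rfl fun u hu => sum_congr rfl fun a ha => ?_
      simp only [f, hUA u hu a ha, and_true]
      by_cases h : τ ≤ repCount A₁ A₂ (u + a)
      · rw [if_pos h, if_neg (not_lt.2 h), sub_zero]
      · rw [if_neg h, if_pos (not_le.1 h), sub_self]
    rw [h1]
    simp only [sum_sub_distrib, sum_const, nsmul_eq_mul, mul_one]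
    linarith
  have hD0 : 1 - δ ≤ D 0 := by
    rw [hD]
    simp only [add_zero]
    rw [le_div_iff₀ (by positivity)]
    linarith
  refine ⟨?_, U, A, T, hUne, hAne, hTne, hTsub, hTcard', ?_⟩
  · by_contra! hcon
    have h1 : ∑ u ∈ U, ∑ a ∈ A, f (u + a) = 0 :=
      sum_eq_zero fun u _ => sum_eq_zero fun a _ => by
        simp only [f]
        rw [if_neg fun h => not_lt.2 h.1 (hcon _)]
    rw [h1] at hbad'
    have : 0 < (U.card : ℝ) * A.card * (1 - δ) := mul_pos (by positivity) (by linarith)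
    linarith
  · have hpt : ∀ v ∈ Fintype.piFinset (fun _ : Fin k => T ×ˢ T),
        U.card * A.card * (τ * (1 - δ - k * η)) ≤ ∑ u ∈ U, ∑ a ∈ A,
          (repCount A₁ A₂ (u + a + ∑ i, ((v i).1 - (v i).2) + 0) : ℝ) := by
      intro v hv
      have h1 := abs_sub_le_of_forall_shift (D := D) hTper v (Fintype.mem_piFinset.1 hv)
      have h2 : 1 - δ - k * η ≤ D (∑ i, ((v i).1 - (v i).2)) := by
        have := (abs_le.1 h1).1
        simp only [hD] at hD0 ⊢
        linarith
      simp only [hD] at h2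
      rw [le_div_iff₀ (by positivity)] at h2
      calc U.card * A.card * (τ * (1 - δ - k * η))
          = τ * ((1 - δ - k * η) * (U.card * A.card)) := by ring
        _ ≤ τ * ∑ u ∈ U, ∑ a ∈ A, f (u + a + ∑ i, ((v i).1 - (v i).2)) := by gcongr
        _ ≤ _ := by
            simp_rw [mul_sum, add_zero]
            exact sum_le_sum fun u _ => sum_le_sum fun a _ => hfτ _
    have h3 := sum_le_sum hpt
    rw [sum_const, Fintype.card_piFinset_const, card_product, nsmul_eq_mul] at h3
    refine le_trans (le_of_eq ?_) h3
    push_cast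
    rw [← sq]
    ring

end Core

/-! ### Choice of parameters -/

section Parameters

lemma logFactor_eq {t : ℝ} (ht : 0 < t) : logFactor t = Real.log 2 - Real.log t := by
  rw [logFactor, Real.log_div (by norm_num) ht.ne']

set_option maxHeartbeats 1000000 in
/-- The choice of the number `k` of convolutions, the moment `2m`, the number `l` of samples and the
rank `N`. -/
lemma exists_parameters {ε α₁ α₂ : ℝ} {p : ℕ} (hε : 0 < ε) (hε1 : ε ≤ 1) (hα₁ : 0 < α₁)
    (hα₁1 : α₁ ≤ 1) (hα₂ : 0 < α₂) (hα₂1 : α₂ ≤ 1) (hp : 0 < p) :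
    ∃ k m l N : ℕ, 0 < k ∧ 0 < m ∧ 0 < l ∧ 0 < N ∧ 2 / 4 ^ k ≤ ε * √(α₁ * α₂) / 8 ∧
      32 * (24 * m / l : ℝ) ^ m ≤ α₁ ^ p * (ε / (32 * k)) ^ (2 * m) ∧
      8 * Real.log (8 / (α₂ ^ p / 8) ^ l) < N ∧
      (N : ℝ) ≤ 1076428800 * ((ε ^ 2)⁻¹ * (p : ℝ) ^ 2 *
          logFactor (ε * √(α₁ * α₂)) ^ 2 * logFactor α₁ * logFactor α₂) := by
  have hlog2 : (0.69 : ℝ) < Real.log 2 := by linarith [Real.log_two_gt_d9]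
  have hp1 : (1 : ℝ) ≤ p := by exact_mod_cast hp
  have hs0 : 0 < √(α₁ * α₂) := Real.sqrt_pos.2 (by positivity)
  have hs1 : √(α₁ * α₂) ≤ 1 := Real.sqrt_le_one.2 (mul_le_one₀ hα₁1 hα₂.le hα₂1)
  set θ : ℝ := ε * √(α₁ * α₂) with hθ
  have hθ0 : 0 < θ := by positivity
  have hθ1 : θ ≤ 1 := mul_le_one₀ hε1 hs0.le hs1
  have hy : Real.log θ ≤ 0 := Real.log_nonpos hθ0.le hθ1
  have ha₁ : Real.log α₁ ≤ 0 := Real.log_nonpos hα₁.le hα₁1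
  have ha₂ : Real.log α₂ ≤ 0 := Real.log_nonpos hα₂.le hα₂1
  have hL := logFactor_eq hθ0
  have hL₁ := logFactor_eq hα₁
  have hL₂ := logFactor_eq hα₂
  have h3e : Real.exp 1 ≤ 3 := by linarith [Real.exp_one_lt_d9]
  have he3 : (16 : ℝ) ≤ Real.exp 3 := by
    rw [show (3 : ℝ) = ((3 : ℕ) : ℝ) * 1 by norm_num, Real.exp_nat_mul]
    calc (16 : ℝ) ≤ 2.7 ^ 3 := by norm_num
      _ ≤ Real.exp 1 ^ 3 := by gcongr; linarith [Real.exp_one_gt_d9]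
  have he4 : (32 : ℝ) ≤ Real.exp 4 := by
    rw [show (4 : ℝ) = ((4 : ℕ) : ℝ) * 1 by norm_num, Real.exp_nat_mul]
    calc (32 : ℝ) ≤ 2.7 ^ 4 := by norm_num
      _ ≤ Real.exp 1 ^ 4 := by gcongr; linarith [Real.exp_one_gt_d9]
  have hpa₁ : p * Real.log α₁ ≤ 0 := mul_nonpos_of_nonneg_of_nonpos (by linarith) ha₁
  have hpa₂ : p * Real.log α₂ ≤ 0 := mul_nonpos_of_nonneg_of_nonpos (by linarith) ha₂
  -- The choice of k gives 4^k ≥ e^k ≥ 16/θ, and that of m gives 3^m ≥ e^m ≥ 32α₁^{-p}.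
  obtain ⟨k, hk1, hk2⟩ : ∃ k : ℕ, 3 - Real.log θ ≤ k ∧ (k : ℝ) < 3 - Real.log θ + 1 :=
    ⟨_, Nat.le_ceil _, Nat.ceil_lt_add_one (by linarith)⟩
  obtain ⟨m, hm1, hm2⟩ : ∃ m : ℕ, 4 - p * Real.log α₁ ≤ m ∧ (m : ℝ) < 4 - p * Real.log α₁ + 1 :=
    ⟨_, Nat.le_ceil _, Nat.ceil_lt_add_one (by linarith)⟩
  have hk0 : (1 : ℝ) ≤ k := by linarith
  have hm0 : (1 : ℝ) ≤ m := by linarith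
  set η : ℝ := ε / (32 * k) with hη
  have hη0 : 0 < η := by positivity
  have hη1 : η ≤ 1 := by rw [hη, div_le_one (by positivity)]; linarith
  have hη2 : η ^ 2 ≤ 1 := pow_le_one₀ hη0.le hη1
  -- The constant 72 makes 24m/l ≤ η²/3; the spare 3^{-m} absorbs 32α₁^{-p}.
  obtain ⟨l, hl1, hl2⟩ : ∃ l : ℕ, 72 * m / η ^ 2 ≤ l ∧ (l : ℝ) < 72 * m / η ^ 2 + 1 :=
    ⟨_, Nat.le_ceil _, Nat.ceil_lt_add_one (by positivity)⟩
  have hmη : (1 : ℝ) ≤ m / η ^ 2 := by rw [le_div_iff₀ (by positivity)]; linarith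
  have hl0 : (1 : ℝ) ≤ l := by
    have : 72 * m / η ^ 2 = 72 * (m / η ^ 2) := by ring
    linarith
  have hpL₁ : p * logFactor α₁ = p * Real.log 2 - p * Real.log α₁ := by rw [hL₁]; ring
  have hpL₂ : p * logFactor α₂ = p * Real.log 2 - p * Real.log α₂ := by rw [hL₂]; ring
  have hplog2 : Real.log 2 ≤ p * Real.log 2 :=
    le_mul_of_one_le_left (by linarith) hp1
  have hpL₂0 : 0.69 ≤ p * logFactor α₂ := by linarith
  -- Here 48 = 8 · (3 + 3): both log 8 and log(8α₂^{-p}) are at most 3p𝓛(α₂), and l ≥ 1.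
  obtain ⟨N, hN1, hN2⟩ : ∃ N : ℕ, 48 * (l * (p * logFactor α₂)) < N ∧
      (N : ℝ) ≤ 48 * (l * (p * logFactor α₂)) + 1 :=
    ⟨⌊48 * (l * (p * logFactor α₂))⌋₊ + 1, by exact_mod_cast Nat.lt_floor_add_one _, by
      push_cast
      gcongr
      exact Nat.floor_le (by positivity)⟩
  have hlpL : (0.69 : ℝ) ≤ l * (p * logFactor α₂) :=
    hpL₂0.trans (le_mul_of_one_le_left (by linarith) hl0)
  refine ⟨k, m, l, N, by exact_mod_cast hk0, by exact_mod_cast hm0, by exact_mod_cast hl0, ?_, ?_,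
    ?_, ?_, ?_⟩
  · have : (0 : ℝ) < N := by linarith
    exact_mod_cast this
  · have h1 : Real.exp (3 - Real.log θ) ≤ 4 ^ k := by
      calc Real.exp (3 - Real.log θ) ≤ Real.exp k := Real.exp_le_exp.2 hk1
        _ = Real.exp 1 ^ k := by rw [← Real.exp_nat_mul, mul_one]
        _ ≤ 4 ^ k := by gcongr; linarith
    rw [Real.exp_sub, Real.exp_log hθ0, div_le_iff₀ hθ0] at h1
    rw [div_le_div_iff₀ (by positivity) (by norm_num)]
    linarith
  · have h1 : 24 * m / l ≤ η ^ 2 / 3 := by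
      rw [div_le_div_iff₀ (by linarith) (by norm_num)]
      rw [div_le_iff₀ (by positivity)] at hl1
      linarith
    have h2 : 32 ≤ α₁ ^ p * 3 ^ m := by
      have h3 : Real.exp (4 - p * Real.log α₁) ≤ 3 ^ m := by
        calc Real.exp (4 - p * Real.log α₁) ≤ Real.exp m := Real.exp_le_exp.2 hm1
          _ = Real.exp 1 ^ m := by rw [← Real.exp_nat_mul, mul_one]
          _ ≤ 3 ^ m := by gcongr
      rw [Real.exp_sub, Real.exp_nat_mul, Real.exp_log hα₁, div_le_iff₀ (by positivity)] at h3
      linarith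
    calc 32 * (24 * m / l : ℝ) ^ m ≤ α₁ ^ p * 3 ^ m * (η ^ 2 / 3) ^ m := by gcongr
      _ = α₁ ^ p * η ^ (2 * m) := by
          rw [div_pow, pow_mul]; field_simp
  · refine lt_of_le_of_lt ?_ hN1
    have h8 : Real.log 8 = 3 * Real.log 2 := by
      rw [show (8 : ℝ) = 2 ^ 3 by norm_num, Real.log_pow]; norm_num
    rw [Real.log_div (by norm_num) (by positivity), Real.log_pow,
      Real.log_div (by positivity) (by norm_num), Real.log_pow, h8]
    have h1 : Real.log 2 ≤ l * (p * logFactor α₂) :=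
      (show Real.log 2 ≤ p * logFactor α₂ by linarith).trans
        (le_mul_of_one_le_left (by linarith) hl0)
    have h2 : l * (3 * Real.log 2 - p * Real.log α₂) ≤ l * (3 * (p * logFactor α₂)) := by
      gcongr
      linarith
    linarith
  · have hk6 : (k : ℝ) ≤ 6 * logFactor θ := by linarith
    have hm8 : (m : ℝ) ≤ 8 * (p * logFactor α₁) := by linarith
    have hηinv : 1 / η ^ 2 = 1024 * k ^ 2 * (ε ^ 2)⁻¹ := by
      rw [hη]; field_simp; norm_num
    have hl73 : (l : ℝ) ≤ 73 * (m * (1 / η ^ 2)) := by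
      have h1 : 72 * m / η ^ 2 = 72 * (m / η ^ 2) := by ring
      have h2 : m * (1 / η ^ 2) = m / η ^ 2 := by ring
      linarith
    have hLθ : 0 ≤ logFactor θ := by linarith
    have hL1 : 0 ≤ logFactor α₁ := by linarith
    have hL2 : 0 ≤ logFactor α₂ := by linarith
    calc (N : ℝ) ≤ 50 * (l * (p * logFactor α₂)) := by linarith
      _ ≤ 50 * (73 * (m * (1 / η ^ 2)) * (p * logFactor α₂)) := by gcongr
      _ = 50 * (73 * (m * (1024 * k ^ 2 * (ε ^ 2)⁻¹)) * (p * logFactor α₂)) := by rw [hηinv]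
      _ ≤ 50 * (73 * (8 * (p * logFactor α₁) * (1024 * (6 * logFactor θ) ^ 2 * (ε ^ 2)⁻¹)) *
            (p * logFactor α₂)) := by gcongr
      _ = _ := by ring

/-- Powers beat the loss in the sifting threshold. -/
lemma sifting_threshold_pow_le {ε R : ℝ} {p : ℕ} (hε : 0 < ε) (hε1 : ε ≤ 1) (hR : 0 ≤ R)
    (hp : 56 * ε⁻¹ * logFactor ε ≤ p) :
    ((1 + 3 / 4 * ε) * R) ^ p ≤ ε / 32 / 4 * ((1 + ε) * R) ^ p := by
  have h1 : (1 + 3 / 4 * ε) * R ≤ (1 - ε / 8) * ((1 + ε) * R) := by nlinarith [mul_nonneg hε.le hR]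
  -- Since 56 = 8 · 7, exp(-εp/8) ≤ (ε/2)^7 ≤ ε/2^7.
  have h2 : (1 - ε / 8) ^ p ≤ ε / 32 / 4 := by
    have h3 : (1 - ε / 8) ^ p ≤ Real.exp (-(ε / 8)) ^ p :=
      pow_le_pow_left₀ (by linarith) (by linarith [Real.add_one_le_exp (-(ε / 8))]) p
    refine h3.trans ?_
    rw [← Real.exp_nat_mul, ← Real.le_log_iff_exp_le (by positivity),
      show ε / 32 / 4 = ε / 2 ^ 7 by ring, Real.log_div hε.ne' (by positivity), Real.log_pow]
    rw [logFactor_eq hε] at hp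
    have h4 : ε * (56 * ε⁻¹ * (Real.log 2 - Real.log ε)) ≤ ε * p := by gcongr
    rw [show ε * (56 * ε⁻¹ * (Real.log 2 - Real.log ε)) = 56 * (Real.log 2 - Real.log ε) by
      field_simp] at h4
    have h5 : Real.log ε ≤ 0 := Real.log_nonpos hε.le hε1
    have h6 : (p : ℝ) * -(ε / 8) = -(ε * p) / 8 := by ring
    rw [h6]
    push_cast
    linarith
  calc ((1 + 3 / 4 * ε) * R) ^ p ≤ ((1 - ε / 8) * ((1 + ε) * R)) ^ p :=
        pow_le_pow_left₀ (by positivity) h1 p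
    _ = (1 - ε / 8) ^ p * ((1 + ε) * R) ^ p := mul_pow _ _ _
    _ ≤ _ := by gcongr

end Parameters

/-! ### Density increment and final assembly -/

section DensityIncrement

variable {G : Type*} [AddCommGroup G] [Fintype G] [DecidableEq G]

lemma inv_dens_eq {G : Type*} [Fintype G] (B : Finset G) :
    ((B.dens : ℝ))⁻¹ = Fintype.card G / B.card := by
  rw [dens]
  push_cast
  rw [inv_div]

/-- A large average of the representation function over a symmetric set `S` yields a large value of
`μ_{A₁} * μ_S`. -/
lemma le_norm_convAvg_of_le_sum_repCount {A₁ A₂ S : Finset G} (hA₁ : A₁.Nonempty)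
    (hA₂ : A₂.Nonempty) (hS : S.Nonempty) (hneg : ∀ s ∈ S, -s ∈ S) {X : ℝ} {z : G}
    (h : S.card * X ≤ ∑ s ∈ S, (repCount A₁ A₂ (z + s) : ℝ)) :
    Fintype.card G / (A₁.card * A₂.card) * X ≤ ‖convAvg (normInd A₁) (normInd S)‖ := by
  have h1 : (0 : ℝ) < A₁.card := by exact_mod_cast hA₁.card_pos
  have h2 : (0 : ℝ) < A₂.card := by exact_mod_cast hA₂.card_pos
  have h3 : (0 : ℝ) < S.card := by exact_mod_cast hS.card_pos
  obtain ⟨w, hw⟩ := exists_le_card_filter_add_mem hA₂ h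
  refine le_trans ?_ (norm_le_pi_norm _ w)
  refine le_trans ?_ (le_abs_self _)
  rw [convAvg_normInd A₁ S hneg]
  calc Fintype.card G / (A₁.card * A₂.card) * X
      = Fintype.card G / (A₁.card * S.card) * (S.card * X / A₂.card) := by field_simp
    _ ≤ _ := by gcongr

end DensityIncrement

set_option maxHeartbeats 1000000 in
open scoped Classical in
/-- All four constants are absolute. The norm `‖·‖` on `G → ℝ` in the last line is the maximum
norm. -/
theorem proposition3p4 :
    ∃ c C K k : ℝ, 0 < c ∧ 0 < C ∧ 0 < K ∧ 0 < k ∧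
      ∀ (G : Type*) [AddCommGroup G] [Fintype G]
        -- the Bohr sets `B⁽¹⁾ = Bohr(Γ₁; ρ₁)` and `B⁽²⁾ = Bohr(Γ; ρ)`
        (Γ₁ Γ : Finset (AddChar G ℂ)) (ρ₁ ρ : ℝ) (d : ℕ),
        Γ₁.Nonempty → Γ.Nonempty → Γ₁.card = d → Γ.card = d →
        0 ≤ ρ₁ → 0 ≤ ρ → ρ ≤ 2 →
        IsRegularBohr Γ₁ ρ₁ → IsRegularBohr Γ ρ →
        bohr Γ ρ ⊆ bohr Γ₁ (c / d * ρ₁) →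
      ∀ (A₁ A₂ B : Finset G) (t₁ t₂ : G) (α₁ α₂ : ℝ),
        B.Nonempty → A₁ ⊆ translateBy B t₁ → A₂ ⊆ translateBy B t₂ →
        α₁ = (A₁.card : ℝ) / B.card → α₂ = (A₂.card : ℝ) / B.card → 0 < α₁ → 0 < α₂ →
      ∀ (x : G) (ε : ℝ) (p : ℕ),
        0 < ε → ε ≤ 1 → C * ε⁻¹ * logFactor ε ≤ p →
        (1 + ε) * (B.dens : ℝ)⁻¹ ≤
          wLpNorm p (convAvg (normInd (bohr Γ₁ ρ₁)) (normInd (translateBy (bohr Γ ρ) x)))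
            (diffConvAvg (normInd A₁) (normInd A₂)) →
      ∃ (Δ : Finset (AddChar G ℂ)) (ρ' : ℝ),
        Δ.Nonempty ∧
        (Δ.card : ℝ) ≤ K * ((ε ^ 2)⁻¹ * (p : ℝ) ^ 2 *
          logFactor (ε * Real.sqrt (α₁ * α₂)) ^ 2 * logFactor α₁ * logFactor α₂) ∧
        k * (ρ * ε * Real.sqrt (α₁ * α₂) / ((d : ℝ) ^ 3 * Δ.card)) ≤ ρ' ∧
        IsRegularBohr (Γ ∪ Δ) ρ' ∧
        (1 + ε / 2) * (B.dens : ℝ)⁻¹ ≤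
          ‖convAvg (normInd A₁) (normInd (bohr (Γ ∪ Δ) ρ'))‖ := by
  -- 262144000000 = 1280000 · 8 · (100 · 16) · 16: the loss in `exists_bohr_annihilating_spectrum`,
  -- ν = εs/8, r ≥ ρ/(1600d), and the last passage to a regular width.
  refine ⟨1 / 200, 56, 1076428800, 1 / 262144000000, by norm_num, by norm_num, by norm_num,
    by norm_num, ?_⟩
  intro G _ _ Γ₁ Γ ρ₁ ρ d hΓ₁ hΓ hd₁ hd hρ₁ hρ hρ2 hreg₁ hreg hsub A₁ A₂ B t₁ t₂ α₁ α₂ hB hA₁B hA₂B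
    hα₁ hα₂ hα₁0 hα₂0 x ε p hε hε1 hp hnorm
  subst hd
  have hG0 : (0 : ℝ) < Fintype.card G := by exact_mod_cast Fintype.card_pos
  have hn : (0 : ℝ) < B.card := by exact_mod_cast hB.card_pos
  have hd1 : (1 : ℝ) ≤ Γ.card := by exact_mod_cast hΓ.card_pos
  have hA₁0 : (0 : ℝ) < A₁.card := by
    rw [hα₁] at hα₁0; exact (div_pos_iff_of_pos_right hn).1 hα₁0
  have hA₂0 : (0 : ℝ) < A₂.card := by
    rw [hα₂] at hα₂0; exact (div_pos_iff_of_pos_right hn).1 hα₂0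
  have hA₁ : A₁.Nonempty := card_pos.1 (by exact_mod_cast hA₁0)
  have hA₂ : A₂.Nonempty := card_pos.1 (by exact_mod_cast hA₂0)
  have hα₁1 : α₁ ≤ 1 := by
    rw [hα₁, div_le_one hn, ← card_translateBy B t₁]
    exact_mod_cast card_le_card hA₁B
  have hα₂1 : α₂ ≤ 1 := by
    rw [hα₂, div_le_one hn, ← card_translateBy B t₂]
    exact_mod_cast card_le_card hA₂B
  have hlogε : 0 < logFactor ε := by
    rw [logFactor]
    exact Real.log_pos (by rw [lt_div_iff₀ hε]; linarith)
  have hp0 : 0 < p := by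
    have : (0 : ℝ) < p := lt_of_lt_of_le (by positivity) hp
    exact_mod_cast this
  obtain ⟨k, m, l, N, hk, hm, hl, hN, hν, hηl, hNlog, hNK⟩ :=
    exists_parameters hε hε1 hα₁0 hα₁1 hα₂0 hα₂1 hp0
  have hk0 : (0 : ℝ) < k := by exact_mod_cast hk
  have hN0 : (1 : ℝ) ≤ N := by exact_mod_cast hN
  set R : ℝ := A₁.card * A₂.card / B.card with hR
  have hR0 : 0 < R := by positivity
  set s : ℝ := √(α₁ * α₂) with hs
  have hs0 : 0 < s := Real.sqrt_pos.2 (by positivity)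
  have hs1 : s ≤ 1 := Real.sqrt_le_one.2 (mul_le_one₀ hα₁1 hα₂0.le hα₂1)
  have hsR : s * √(A₁.card * A₂.card) = R := by
    rw [hs, ← Real.sqrt_mul (by positivity), hα₁, hα₂,
      show (A₁.card / B.card * (A₂.card / B.card) * (A₁.card * A₂.card) : ℝ) = R ^ 2 by
        rw [hR]; ring, Real.sqrt_sq hR0.le]
  have hmom := le_sum_repCount_pow_of_le_wLpNorm (M := (1 + ε) * R) hp0 hA₁ hA₂
    ⟨0, zero_mem_bohr Γ₁ hρ₁⟩ ((show (bohr Γ ρ).Nonempty from ⟨0, zero_mem_bohr Γ hρ⟩).map)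
    (by positivity) (by
      refine le_trans (le_of_eq ?_) hnorm
      rw [inv_dens_eq, hR]; field_simp)
  obtain ⟨r, hrl, hru, hregr⟩ := exists_isRegularBohr hΓ (R := 1 / (100 * (Γ.card : ℝ)) * ρ)
    (by positivity)
  have hr0 : 0 ≤ r := le_trans (by positivity) hrl
  obtain ⟨⟨z, hz⟩, U, A, T, hU, hA, hT, hTsub, hTcard, hsm⟩ := exists_smoothedRepCount_ge
    (k := k) hΓ₁ hΓ hd₁ hρ₁ hρ hreg₁ hreg
    (by
      rw [show 1 / (200 * (Γ.card : ℝ)) = 1 / 200 / Γ.card by rw [div_div]]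
      exact hsub)
    hr0 hru hn hA₁ hA₂
    (show A₁.card * A₂.card / B.card ≤ (1 + ε) * R from
      le_mul_of_one_le_left hR0.le (by linarith))
    (show 0 ≤ (1 + 3 / 4 * ε) * R by positivity) (show 0 < ε / 32 by positivity) (by linarith)
    (sifting_threshold_pow_le hε hε1 hR0.le hp) hmom hl hm
    (show 0 ≤ ε / (32 * k) by positivity) (by rw [← hα₁]; exact hηl)
  rw [← hα₂] at hTcard
  have hfinish : ∀ S : Finset G, S.Nonempty → (∀ y ∈ S, -y ∈ S) →
      (∃ z, S.card * ((1 + ε / 2) * R) ≤ ∑ y ∈ S, (repCount A₁ A₂ (z + y) : ℝ)) →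
      (1 + ε / 2) * (B.dens : ℝ)⁻¹ ≤ ‖convAvg (normInd A₁) (normInd S)‖ := by
    rintro S hS hneg ⟨z, hz⟩
    refine le_trans (le_of_eq ?_) (le_norm_convAvg_of_le_sum_repCount hA₁ hA₂ hS hneg hz)
    rw [inv_dens_eq, hR]; field_simp
  -- If N exceeds the number of characters, Δ can be the whole dual group. Then B' = {0}, and a
  -- single popular point z suffices.
  by_cases hNG : N ≤ Fintype.card (AddChar G ℂ)
  · have hT0 : (0 : ℝ) < T.card := by exact_mod_cast hT.card_pos
    have hBr0 : (0 : ℝ) < (bohr Γ r).card := by exact_mod_cast card_bohr_pos Γ hr0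
    obtain ⟨Δ, r', hΔ, hr'0, hr'l, hreg', hann⟩ := exists_bohr_annihilating_spectrum hΓ hr0 hregr
      hTsub hT (ν := ε * s / 8) (by positivity)
      (by linarith [mul_le_one₀ hε1 hs0.le hs1]) hN (by
        refine lt_of_le_of_lt ?_ hNlog
        refine mul_le_mul_of_nonneg_left (Real.log_le_log (by positivity) ?_) (by norm_num)
        rw [div_le_div_iff₀ hT0 (by positivity)]
        linarith) hNG
    refine ⟨Δ, r', card_pos.1 (hΔ ▸ hN), by rw [hΔ]; exact hNK, le_trans ?_ hr'l, hreg', ?_⟩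
    · rw [hΔ, le_div_iff₀ (by norm_num), le_min_iff]
      constructor
      · calc 1 / 262144000000 * (ρ * ε * s / ((Γ.card : ℝ) ^ 3 * N)) * 16
            = ε * s / 8 * (1 / (100 * (Γ.card : ℝ)) * ρ / 16) / (1280000 * (Γ.card : ℝ) ^ 2 * N) := by
              field_simp; ring
          _ ≤ _ := by gcongr
      · have hd3 : (1 : ℝ) ≤ (Γ.card : ℝ) ^ 3 := one_le_pow₀ hd1
        have h1 : ρ * ε * s / ((Γ.card : ℝ) ^ 3 * N) ≤ 2 * ε * s / (1 * N) := by gcongr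
        have h2 : ε * s / 8 / (2 * N) = 2 * ε * s / (1 * N) / 32 := by ring
        have h3 : 0 ≤ 2 * ε * s / (1 * N) := by positivity
        rw [h2]
        linarith
    · refine hfinish _ ⟨0, zero_mem_bohr _ hr'0⟩ (fun _ => neg_mem_bohr) ?_
      refine exists_le_sum_repCount (k := k) hU hA hT fun y hy => ?_
      have h1 := abs_smoothedRepCount_sub_le A₁ A₂ U A T hν (hann y hy)
      have h2 := (abs_le.1 h1).1
      set Q : ℝ := U.card * A.card * ((T.card : ℝ) ^ 2) ^ k with hQ
      have hQ0 : 0 ≤ Q := by positivity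
      have h3 : Q * (ε * s / 8) * √(A₁.card * A₂.card) = Q * (ε / 8 * R) := by
        rw [← hsR]; ring
      rw [h3] at h2
      have h4 : k * (ε / (32 * k)) = ε / 32 := by field_simp
      rw [h4] at hsm
      -- The losses are ε/32 from sifting, kη = ε/32 from almost periodicity and εR/8 from the shift
      -- by y; the threshold 1 + 3ε/4 leaves room for all three.
      have h5 : (1 + ε / 2) * R ≤ (1 + 3 / 4 * ε) * R * (1 - ε / 32 - ε / 32) - ε / 8 * R := by
        have h6 : 1 + ε / 2 ≤ (1 + 3 / 4 * ε) * (1 - ε / 32 - ε / 32) - ε / 8 := by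
          have h7 : ε * ε ≤ ε := mul_le_of_le_one_left hε.le hε1
          have h8 : (1 + 3 / 4 * ε) * (1 - ε / 32 - ε / 32) - ε / 8 =
              1 + 9 / 16 * ε - 3 / 64 * (ε * ε) := by ring
          linarith
        calc (1 + ε / 2) * R ≤ ((1 + 3 / 4 * ε) * (1 - ε / 32 - ε / 32) - ε / 8) * R := by gcongr
          _ = _ := by ring
      have h6 := mul_le_mul_of_nonneg_left h5 hQ0
      linarith
  · have hcard : (univ : Finset (AddChar G ℂ)).card < N := by
      rw [card_univ]; exact not_le.1 hNG
    have huniv : (1 : ℝ) ≤ (univ : Finset (AddChar G ℂ)).card := by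
      exact_mod_cast card_pos.2 ⟨0, mem_univ _⟩
    refine ⟨univ, 1 / 4, ⟨0, mem_univ _⟩, ?_, ?_, ?_, ?_⟩
    · refine le_trans ?_ hNK
      exact_mod_cast hcard.le
    · have hd3 : (1 : ℝ) ≤ (Γ.card : ℝ) ^ 3 := one_le_pow₀ hd1
      have h1 : ρ * ε * s / ((Γ.card : ℝ) ^ 3 * (univ : Finset (AddChar G ℂ)).card) ≤
          2 * 1 * 1 / (1 * 1) := by gcongr
      linarith
    · rw [union_eq_right.2 (subset_univ Γ)]
      exact isRegularBohr_univ
    · rw [union_eq_right.2 (subset_univ Γ), bohr_univ_eq_singleton (by norm_num) (by norm_num)]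
      refine hfinish _ (singleton_nonempty 0) (by simp) ⟨z, ?_⟩
      rw [card_singleton, sum_singleton, add_zero, Nat.cast_one, one_mul]
      refine le_trans ?_ hz
      gcongr
      linarith
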